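/- Let $\mathbb K$ be $\mathbb R$ or $\mathbb C$, let $d,k\ge 0$ be integers, and let $\Gamma$ be a discrete group. A $\Gamma$-flow is a Hausdorff topological space $Y$ with a continuous flow $\phi=(\phi^t)_{t\in\mathbb R}$ and a properly discontinuous action of $\Gamma$ on $Y$ by homeomorphisms that commutes with $\phi$; here properly discontinuous means that any two points $x,y\in Y$ have neighbourhoods $U\ni x$, $V\ni y$ such that $\gamma U\cap V\neq\emptyset$ for only finitely many $\gamma\in\Gamma$. The $\Gamma$-flow is cocompact if $\Gamma\backslash Y$ is compact. For a representation $\rho:\Gamma\to \mathrm{SL}(d,\mathbb K)$ let $E_\rho(Y)=\Gamma\backslash (Y\times\mathbb K^d)$ be the flat bundle, where $\gamma(y,v)=(\gamma y,\rho(\gamma)v)$, with the flow induced by $\phi^t(y,v)=(\phi^t(y),v)$. Metrics and subbundles of $E_\rho(Y)$ are understood as $\Gamma$-invariant continuous metrics (Euclidean if $\mathbb K=\mathbb R$, Hermitian if $\mathbb K=\mathbb C$) and $\Gamma$-invariant continuous subbundles of $Y\times\mathbb K^d$. The representation $\rho$ is $k$-Anosov in restriction to $Y$ if there exist a metric $\|\cdot\|$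 on $E_\rho(Y)$, a continuous $\phi$-invariant decomposition $E_\rho(Y)=E^s\oplus E^u$ with $E^s$ of rank $k$, and constants $C,\lambda>0$ such that $$\frac{\|\phi^t(v)\|}{\|\phi^t(w)\|}\le C e^{-\lambda t}\,\frac{\|v\|}{\|w\|}$$ for all $y\in Y$, all $t\ge 0$ and all nonzero vectors $v\in E^s_y$, $w\in E^u_y$. Proposition. Let $(Y,\phi)$ be a cocompact $\Gamma$-flow. Then the set $$A^k_Y(\Gamma,\mathrm{SL}(d,\mathbb K))=\{\rho:\Gamma\to\mathrm{SL}(d,\mathbb K)\ :\ \rho \text{ is } k\text{-Anosov in restriction to } Y\}$$ is open in $\mathrm{Hom}(\Gamma,\mathrm{SL}(d,\mathbb K))$ with the topology of pointwise convergence. -/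

import Mathlib

namespace RestrictedAnosov

/-- The action of `Γ` on `Y` is properly discontinuous: any two points have neighbourhoods `U`, `V`
such that `γ U` meets `V` for only finitely many `γ`. For a Hausdorff space this says that the
discrete group `Γ` acts properly. On a locally compact Hausdorff space it is equivalent to the
condition that `γ K` meets `L` for only finitely many `γ`, for all compact sets `K`, `L`. -/
def IsProperlyDiscontinuous (Γ Y : Type*) [Group Γ] [TopologicalSpace Y] [MulAction Γ Y] : Prop :=
  ∀ x y : Y, ∃ U ∈ nhds x, ∃ V ∈ nhds y,
    {γ : Γ | (((fun z : Y => γ • z) '' U) ∩ V).Nonempty}.Finite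

/-- A `Γ`-flow: a Hausdorff space `Y` with a continuous flow and a properly discontinuous action of
`Γ` on `Y` by homeomorphisms that commutes with the flow. -/
structure GammaFlow (Γ Y : Type*) [Group Γ] [TopologicalSpace Y] [MulAction Γ Y]
    extends Flow ℝ Y where
  t2 : T2Space Y
  continuous_action : ∀ γ : Γ, Continuous fun y : Y => γ • y
  properlyDiscontinuous : IsProperlyDiscontinuous Γ Y
  commutes : ∀ (γ : Γ) (t : ℝ) (y : Y), toFun t (γ • y) = γ • toFun t y

/-- The `Γ`-flow is cocompact: the quotient `Γ \ Y` is compact. -/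
def GammaFlow.IsCocompact {Γ Y : Type*} [Group Γ] [TopologicalSpace Y] [MulAction Γ Y]
    (_φ : GammaFlow Γ Y) : Prop :=
  CompactSpace (Quotient (MulAction.orbitRel Γ Y))

/-- The topology of `Hom(Γ, SL(d, K))`, that of pointwise convergence: the subspace topology of the
product topology on the set of all maps `Γ → SL(d, K)`. -/
@[reducible] def homTopology (Γ : Type*) [Group Γ] (d : ℕ) (K : Type*) [RCLike K] :
    TopologicalSpace (Γ →* Matrix.SpecialLinearGroup (Fin d) K) :=
  TopologicalSpace.induced
    (fun (ρ : Γ →* Matrix.SpecialLinearGroup (Fin d) K) (γ : Γ) => ρ γ) inferInstance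

/-- A metric on the flat bundle `E_ρ(Y) = Γ \ (Y × K^d)`, where `γ (y, v) = (γ y, ρ(γ) v)`, written
on the cover `Y × K^d`: a continuous family of positive definite Hermitian forms (symmetric forms
if `K = ℝ`) on `K^d`, parametrised by `Y` and invariant under the action of `Γ`. The form at `y` is
given by its Gram matrix. -/
structure BundleMetric {Γ Y K : Type*} [Group Γ] [TopologicalSpace Y] [MulAction Γ Y] [RCLike K]
    {d : ℕ} (ρ : Γ →* Matrix.SpecialLinearGroup (Fin d) K) where
  gram : Y → Matrix (Fin d) (Fin d) K
  continuous_gram : Continuous gram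
  isHermitian : ∀ y, (gram y).IsHermitian
  pos : ∀ y, ∀ v : Fin d → K, v ≠ 0 → 0 < RCLike.re (star v ⬝ᵥ (gram y).mulVec v)
  invariant : ∀ (γ : Γ) (y : Y) (v w : Fin d → K),
    star ((ρ γ).1.mulVec v) ⬝ᵥ (gram (γ • y)).mulVec ((ρ γ).1.mulVec w) =
      star v ⬝ᵥ (gram y).mulVec w

/-- The norm of the vector `v` of the fibre `K^d` over `y`. -/
noncomputable def BundleMetric.norm {Γ Y K : Type*} [Group Γ] [TopologicalSpace Y] [MulAction Γ Y]
    [RCLike K] {d : ℕ} {ρ : Γ →* Matrix.SpecialLinearGroup (Fin d) K}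
    (m : BundleMetric (Y := Y) ρ) (y : Y) (v : Fin d → K) : ℝ :=
  Real.sqrt (RCLike.re (star v ⬝ᵥ (m.gram y).mulVec v))

/-- A family of linear subspaces of `K^d` parametrised by `Y` is a continuous subbundle of rank `r`
of `Y × K^d`: near every point it has a continuous frame with `r` elements. -/
def IsSubbundle {Y K : Type*} [TopologicalSpace Y] [RCLike K] {d : ℕ} (r : ℕ)
    (E : Y → Submodule K (Fin d → K)) : Prop :=
  ∀ y₀ : Y, ∃ U ∈ nhds y₀, ∃ s : Fin r → Y → (Fin d → K),
    (∀ i, ContinuousOn (s i) U) ∧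
    ∀ y ∈ U, LinearIndependent K (fun i => s i y) ∧
      Submodule.span K (Set.range fun i => s i y) = E y

/-- The family of subspaces is invariant under `γ (y, v) = (γ y, ρ(γ) v)`, that is, it descends to
`E_ρ(Y)`. -/
def IsGroupInvariant {Γ Y K : Type*} [Group Γ] [MulAction Γ Y] [RCLike K] {d : ℕ}
    (ρ : Γ →* Matrix.SpecialLinearGroup (Fin d) K) (E : Y → Submodule K (Fin d → K)) : Prop :=
  ∀ (γ : Γ) (y : Y), E (γ • y) = (E y).map (Matrix.toLin' (ρ γ).1)

/-- The family of subspaces is invariant under the lifted flow `φ^t (y, v) = (φ^t y, v)`. -/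
def IsFlowInvariant {Y K : Type*} [TopologicalSpace Y] [RCLike K] {d : ℕ}
    (φ : Flow ℝ Y) (E : Y → Submodule K (Fin d → K)) : Prop :=
  ∀ (t : ℝ) (y : Y), E (φ t y) = E y

/-- `Es ⊕ Eu` is a dominated splitting of rank `k` of the flat bundle `E_ρ(Y)` with respect to the
metric `m`, written on the cover `Y × K^d`. The lifted flow is `φ^t (y, v) = (φ^t y, v)`. -/
structure IsDominatedSplitting {Γ Y K : Type*} [Group Γ] [TopologicalSpace Y] [MulAction Γ Y]
    [RCLike K] {d : ℕ} (φ : GammaFlow Γ Y) (k : ℕ)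
    (ρ : Γ →* Matrix.SpecialLinearGroup (Fin d) K) (m : BundleMetric (Y := Y) ρ)
    (Es Eu : Y → Submodule K (Fin d → K)) : Prop where
  stable_subbundle : IsSubbundle k Es
  unstable_subbundle : IsSubbundle (d - k) Eu
  isCompl : ∀ y, IsCompl (Es y) (Eu y)
  stable_group : IsGroupInvariant ρ Es
  unstable_group : IsGroupInvariant ρ Eu
  stable_flow : IsFlowInvariant φ.toFlow Es
  unstable_flow : IsFlowInvariant φ.toFlow Eu
  dominated : ∃ C : ℝ, 0 < C ∧ ∃ a : ℝ, 0 < a ∧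
    ∀ (y : Y) (t : ℝ), 0 ≤ t → ∀ v ∈ Es y, v ≠ 0 → ∀ w ∈ Eu y, w ≠ 0 →
      m.norm (φ.toFlow t y) v / m.norm (φ.toFlow t y) w ≤
        C * Real.exp (-a * t) * (m.norm y v / m.norm y w)

/-- `ρ` is `k`-Anosov in restriction to the `Γ`-flow `φ` on `Y`. -/
def IsAnosovInRestriction {Γ Y K : Type*} [Group Γ] [TopologicalSpace Y] [MulAction Γ Y]
    [RCLike K] {d : ℕ} (φ : GammaFlow Γ Y) (k : ℕ)
    (ρ : Γ →* Matrix.SpecialLinearGroup (Fin d) K) : Prop :=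
  ∃ (m : BundleMetric (Y := Y) ρ) (Es Eu : Y → Submodule K (Fin d → K)),
    IsDominatedSplitting φ k ρ m Es Eu

end RestrictedAnosov

namespace RestrictedAnosov

open Filter Topology

/-! Dominated splittings persist because they are detected by a cone condition over a bounded time,
and such a condition survives small perturbations.

To compare nearby representations on one bundle, the matrices `ρ γ * (ρ₀ γ)⁻¹` are averaged against
a compactly supported cutoff whose translates sum to 1. The result `g` is equivariant. Over a
compact set only finitely many `γ` contribute, so pointwise convergence `ρ → ρ₀` brings `g`
uniformly close to the identity there. By cocompactness this yields, over all of `Y`, an estimate in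
the invariant metric for flow times in a bounded interval (`BundleMetric.exists_close`).

Put `q = g⁻¹`, and let `a`, `b` be the norms of the stable and unstable components of `q y v` in the
splitting for `ρ₀`. The lifted flow fixes `v`, so only the seminorms move. For large `T` the
domination for `ρ₀` absorbs the constants lost in the perturbation on `[T, 2T]`, which gives
`ConeDomination` (`IsDominatedSplitting.component_contraction`).

The vectors that stay in the cone `a ≤ b` along the whole orbit form the new unstable bundle;
reversing time and swapping `a`, `b` gives the stable one. Domination makes this set linear, a
compactness argument gives it the right dimension (`ConeDomination.exists_mem_bundle`), and
closedness of its total space makes it continuous (`ConeDomination.continuous_projection`). -/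

/-- Two families of seminorms along a flow, for which the cone `a ≤ b` is mapped into itself and is
dominating. -/
structure ConeDomination {Y K V : Type*} [TopologicalSpace Y] [RCLike K] [NormedAddCommGroup V]
    [NormedSpace K V] (φ : Flow ℝ Y) (a b : Y → Seminorm K V) (T : ℝ) : Prop where
  pos : 0 < T
  continuous_left : Continuous fun p : Y × V => a p.1 p.2
  continuous_right : Continuous fun p : Y × V => b p.1 p.2
  definite : ∀ y v, a y v = 0 → b y v = 0 → v = 0
  contract : ∀ y τ, T ≤ τ → τ ≤ 2 * T → ∀ v w, b (φ τ y) v ≤ a (φ τ y) v → a y w ≤ b y w →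
    (a (φ τ y) + b (φ τ y)) v * (a y + b y) w ≤
      1 / 2 * ((a y + b y) v * (a (φ τ y) + b (φ τ y)) w)

/-! ### Dominating cone fields and their invariant bundles -/

namespace ConeDomination

variable {Y K V : Type*} [TopologicalSpace Y] [RCLike K] [NormedAddCommGroup V]
  [NormedSpace K V] {φ : Flow ℝ Y} {a b : Y → Seminorm K V} {T : ℝ}

theorem eq_zero_of_add_nonpos (h : ConeDomination φ a b T) {y : Y} {v : V}
    (hv : (a y + b y) v ≤ 0) : v = 0 := by
  rw [add_apply] at hv
  have h1 := apply_nonneg (a y) v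
  have h2 := apply_nonneg (b y) v
  exact h.definite y v (by linarith) (by linarith)

theorem add_pos (h : ConeDomination φ a b T) {y : Y} {v : V} (hv : v ≠ 0) :
    0 < (a y + b y) v := by
  by_contra! hn
  exact hv (h.eq_zero_of_add_nonpos hn)

/-- The contraction condition tests `v` at the end of the orbit segment and `w` at its start, so it
is symmetric under time reversal. Each result on the unstable bundle thereby has a stable
counterpart. -/
theorem reverse (h : ConeDomination φ a b T) : ConeDomination φ.reverse b a T where
  pos := h.pos
  continuous_left := h.continuous_right
  continuous_right := h.continuous_left
  definite y v h1 h2 := h.definite y v h2 h1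
  contract y τ h1 h2 v w hv hw := by
    have e : φ τ (φ.reverse τ y) = y := by
      change φ τ (φ (-τ) y) = y
      rw [← Flow.map_add]; simp
    have := h.contract (φ.reverse τ y) τ h1 h2 w v (by rwa [e]) hv
    rw [e] at this
    rw [add_comm (b _), add_comm (b _)]
    linarith

/-- Contraction with `v = w` bounds a product by half of itself. Cone invariance is thus a
consequence of contraction, not a separate axiom. -/
theorem eq_zero_of_mem (h : ConeDomination φ a b T) {y : Y} {τ : ℝ} (h1 : T ≤ τ) (h2 : τ ≤ 2 * T)
    {v : V} (hv : a y v ≤ b y v) (hv' : b (φ τ y) v ≤ a (φ τ y) v) : v = 0 := by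
  by_contra h0
  have := h.contract y τ h1 h2 v v hv' hv
  nlinarith [mul_pos (h.add_pos (y := y) h0) (h.add_pos (y := φ τ y) h0)]

theorem cone_step (h : ConeDomination φ a b T) {y : Y} {τ : ℝ} (h1 : T ≤ τ) (h2 : τ ≤ 2 * T)
    {v : V} (hv : a y v ≤ b y v) : a (φ τ y) v ≤ b (φ τ y) v := by
  by_contra! hn
  have := h.eq_zero_of_mem h1 h2 hv hn.le
  simp [this] at hn

theorem iterate (h : ConeDomination φ a b T) {τ : ℝ} (h1 : T ≤ τ) (h2 : τ ≤ 2 * T) (m : ℕ) (y : Y)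
    {w : V} (hw : a y w ≤ b y w) :
    a (φ (m * τ) y) w ≤ b (φ (m * τ) y) w ∧ ∀ v, b (φ (m * τ) y) v ≤ a (φ (m * τ) y) v →
      (a (φ (m * τ) y) + b (φ (m * τ) y)) v * (a y + b y) w ≤
        (1 / 2) ^ m * ((a y + b y) v * (a (φ (m * τ) y) + b (φ (m * τ) y)) w) := by
  induction m with
  | zero => simpa using hw
  | succ m ih =>
    obtain ⟨i1, i2⟩ := ih
    have e : φ (((m + 1 : ℕ) : ℝ) * τ) y = φ τ (φ (m * τ) y) := by
      rw [← Flow.map_add]; congr 1; push_cast; ring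
    rw [e]
    set z := φ (m * τ) y
    refine ⟨h.cone_step h1 h2 i1, fun v hv => ?_⟩
    -- Lying in the opposite cone at the end forces the same at the intermediate time, since a
    -- vector of `a < b` cannot leave the cone forwards. This allows the two estimates to be
    -- chained.
    have hv' : b z v ≤ a z v := by
      by_contra! hn
      have := h.eq_zero_of_mem h1 h2 hn.le hv
      simp [this] at hn
    have c1 := i2 v hv'
    have c2 := h.contract z τ h1 h2 v w hv i1
    by_cases hw0 : w = 0
    · simp [hw0]
    by_cases hv0 : v = 0
    · simp [hv0]
    have p1 := h.add_pos (y := z) hw0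
    have p2 := h.add_pos (y := z) hv0
    have p3 := h.add_pos (y := y) hw0
    have p4 := h.add_pos (y := φ τ z) hv0
    refine le_of_mul_le_mul_right ?_ (mul_pos p1 p2)
    calc _ = ((a (φ τ z) + b (φ τ z)) v * (a z + b z) w) *
          ((a z + b z) v * (a y + b y) w) := by ring
      _ ≤ (1 / 2 * ((a z + b z) v * (a (φ τ z) + b (φ τ z)) w)) *
          ((1 / 2) ^ m * ((a y + b y) v * (a z + b z) w)) :=
        mul_le_mul c2 c1 (by positivity) (by positivity)
      _ = _ := by rw [pow_succ]; ring

/-- This is why contraction is required on the window `[T, 2T]`: every time beyond `T` splits into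
equal steps of admissible length, with no remainder. -/
theorem exists_nat_mul (h : ConeDomination φ a b T) {t : ℝ} (ht : T ≤ t) :
    ∃ (m : ℕ) (τ : ℝ), T ≤ τ ∧ τ ≤ 2 * T ∧ t = m * τ := by
  have hT := h.pos
  have h1 : 1 ≤ t / T := by rwa [le_div_iff₀ hT, one_mul]
  have h2 : (1 : ℝ) ≤ ⌊t / T⌋₊ := by
    have : 1 ≤ ⌊t / T⌋₊ := Nat.le_floor (by simpa using h1)
    exact_mod_cast this
  have h3 := Nat.floor_le (by linarith : 0 ≤ t / T)
  have h4 := Nat.lt_floor_add_one (t / T)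
  rw [le_div_iff₀ hT] at h3
  rw [div_lt_iff₀ hT] at h4
  have h5 : (0 : ℝ) < ⌊t / T⌋₊ := by linarith
  refine ⟨⌊t / T⌋₊, t / ⌊t / T⌋₊, ?_, ?_, by field_simp⟩
  · rw [le_div_iff₀ h5]; linarith
  · rw [div_le_iff₀ h5]; nlinarith

theorem cone_forward (h : ConeDomination φ a b T) {y : Y} {t : ℝ} (ht : T ≤ t)
    {v : V} (hv : a y v ≤ b y v) : a (φ t y) v ≤ b (φ t y) v := by
  obtain ⟨m, τ, h1, h2, rfl⟩ := h.exists_nat_mul ht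
  exact (h.iterate h1 h2 m y hv).1

theorem forall_mem_cone (h : ConeDomination φ a b T) {y : Y} {v : V}
    (hv : ∀ m : ℕ, a (φ (-(m * T)) y) v ≤ b (φ (-(m * T)) y) v) (t : ℝ) :
    a (φ t y) v ≤ b (φ t y) v := by
  have hT := h.pos
  obtain ⟨m, hm⟩ := exists_nat_ge ((T - t) / T)
  rw [div_le_iff₀ hT] at hm
  have e : φ t y = φ (t + m * T) (φ (-(m * T)) y) := by
    rw [← Flow.map_add]; congr 1; ring
  rw [e]
  exact h.cone_forward (by linarith) (hv m)

/-- The vectors that stay in the cone `a ≤ b` along the whole orbit. -/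
def bundle (h : ConeDomination φ a b T) (y : Y) : Submodule K V where
  carrier := {v | ∀ t : ℝ, a (φ t y) v ≤ b (φ t y) v}
  zero_mem' t := by simp
  smul_mem' c v hv t := by
    rw [map_smul_eq_mul, map_smul_eq_mul]
    exact mul_le_mul_of_nonneg_left (hv t) (norm_nonneg _)
  add_mem' := by
    intro v w hv hw t
    -- If `v + w` leaves the cone at `z`, it lies in the opposite cone there. Comparing it with `v`
    -- and with `w` from time `-mT`, then adding, bounds its size at `z` by `2⁻ᵐ` times the sum of
    -- theirs, by the triangle inequality at time `-mT`. This fails for large `m`.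
    by_contra! hn
    set z := φ t y
    have e (m : ℕ) : φ (m * T) (φ (-(m * T)) z) = z := by
      rw [← Flow.map_add]; simp
    have key (u : V) (hu : ∀ t : ℝ, a (φ t y) u ≤ b (φ t y) u) (m : ℕ) :
        (a z + b z) (v + w) * (a (φ (-(m * T)) z) + b (φ (-(m * T)) z)) u ≤
        (1 / 2) ^ m * ((a (φ (-(m * T)) z) + b (φ (-(m * T)) z)) (v + w) * (a z + b z) u) := by
      have h1 : a (φ (-(m * T)) z) u ≤ b (φ (-(m * T)) z) u := by
        have := hu (-(m * T) + t)
        rwa [Flow.map_add] at this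
      have := (h.iterate le_rfl (by linarith [h.pos]) m _ h1).2 (v + w)
      rw [e] at this
      exact this hn.le
    have h0 : v + w ≠ 0 := by
      intro h0
      simp [h0] at hn
    have hp := h.add_pos (y := z) h0
    obtain ⟨m, hm⟩ := exists_pow_lt_of_lt_one
      (div_pos hp (by positivity : (0 : ℝ) < (a z + b z) v + (a z + b z) w + 1))
      (by norm_num : (1 / 2 : ℝ) < 1)
    rw [lt_div_iff₀ (by positivity)] at hm
    have k1 := key v hv m
    have k2 := key w hw m
    have k3 := map_add_le_add (a (φ (-(m * T)) z) + b (φ (-(m * T)) z)) v w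
    have k4 := h.add_pos (y := φ (-(m * T)) z) h0
    have n1 := apply_nonneg (a z + b z) v
    have n2 := apply_nonneg (a z + b z) w
    have n3 : (0 : ℝ) < (1 / 2) ^ m := by positivity
    set q : ℝ := (1 / 2) ^ m
    set A := (a (φ (-(m * T)) z) + b (φ (-(m * T)) z)) (v + w)
    nlinarith [mul_lt_mul_of_pos_right hm k4, mul_le_mul_of_nonneg_left k3 hp.le, mul_pos n3 k4]

theorem mem_bundle (h : ConeDomination φ a b T) {y : Y} {v : V} :
    v ∈ h.bundle y ↔ ∀ t : ℝ, a (φ t y) v ≤ b (φ t y) v := Iff.rfl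

theorem le_of_mem_bundle (h : ConeDomination φ a b T) {y : Y} {v : V} (hv : v ∈ h.bundle y) :
    a y v ≤ b y v := by
  simpa using h.mem_bundle.1 hv 0

theorem bundle_flow (h : ConeDomination φ a b T) (s : ℝ) (y : Y) :
    h.bundle (φ s y) = h.bundle y := by
  ext v
  simp only [mem_bundle, ← Flow.map_add]
  exact ⟨fun hv t => by simpa using hv (t - s), fun hv t => hv _⟩

theorem isClosed_bundle (h : ConeDomination φ a b T) :
    IsClosed {p : Y × V | p.2 ∈ h.bundle p.1} := by
  have : {p : Y × V | p.2 ∈ h.bundle p.1} =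
      ⋂ t : ℝ, {p : Y × V | a (φ t p.1) p.2 ≤ b (φ t p.1) p.2} := by
    ext p; simp [mem_bundle]
  rw [this]
  refine isClosed_iInter fun t => isClosed_le ?_ ?_
  · exact h.continuous_left.comp
      (((φ.continuous continuous_const continuous_fst)).prodMk continuous_snd)
  · exact h.continuous_right.comp
      (((φ.continuous continuous_const continuous_fst)).prodMk continuous_snd)

theorem disjoint_bundle (h : ConeDomination φ a b T) (y : Y) :
    Disjoint (h.bundle y) (h.reverse.bundle y) := by
  rw [Submodule.disjoint_def]
  intro v hv hv'
  refine h.eq_zero_of_mem le_rfl (by linarith [h.pos]) (h.le_of_mem_bundle hv) (τ := T) ?_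
  have := h.reverse.mem_bundle.1 hv' (-T)
  have e : φ.reverse (-T) y = φ T y := by
    change φ (- -T) y = φ T y
    rw [neg_neg]
  rwa [e] at this

theorem dominated_bundle (h : ConeDomination φ a b T) {D : ℝ}
    (hD : ∀ y τ, 0 ≤ τ → τ ≤ T → ∀ v w, b (φ τ y) v ≤ a (φ τ y) v → a y w ≤ b y w →
      (a (φ τ y) + b (φ τ y)) v * (a y + b y) w ≤
        D * ((a y + b y) v * (a (φ τ y) + b (φ τ y)) w)) :
    ∃ C > 0, ∃ α > 0, ∀ y t, 0 ≤ t → ∀ v ∈ h.reverse.bundle y, ∀ w ∈ h.bundle y,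
      (a (φ t y) + b (φ t y)) v * (a y + b y) w ≤
        C * Real.exp (-α * t) * ((a y + b y) v * (a (φ t y) + b (φ t y)) w) := by
  have hT := h.pos
  have hl : 0 < Real.log 2 := Real.log_pos (by norm_num)
  -- A time `t = m * τ` with `τ ≤ 2 * T` has `m ≥ t / (2 * T)`, whence the rate. The factor `exp
  -- (log 2)` offsets the decay on `[0, T]`, where only the bound `D` is available.
  refine ⟨max D 1 * Real.exp (Real.log 2), by positivity, Real.log 2 / (2 * T), by positivity, ?_⟩
  intro y t ht v hv w hw
  have hv' : b (φ t y) v ≤ a (φ t y) v := by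
    have := h.reverse.mem_bundle.1 hv (-t)
    have e : φ.reverse (-t) y = φ t y := by
      change φ (- -t) y = φ t y
      rw [neg_neg]
    rwa [e] at this
  have hw' := h.le_of_mem_bundle hw
  have hN : 0 ≤ (a y + b y) v * (a (φ t y) + b (φ t y)) w :=
    mul_nonneg (apply_nonneg _ _) (apply_nonneg _ _)
  rw [mul_assoc (max D 1), ← Real.exp_add]
  have hM : (1 : ℝ) ≤ max D 1 := le_max_right _ _
  rcases le_total t T with htT | htT
  · refine (hD y t ht htT v w hv' hw').trans (mul_le_mul_of_nonneg_right ?_ hN)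
    have : 1 ≤ Real.exp (Real.log 2 + -(Real.log 2 / (2 * T)) * t) := by
      apply Real.one_le_exp
      have : t / (2 * T) ≤ 1 := by rw [div_le_one (by positivity)]; linarith
      have e : Real.log 2 + -(Real.log 2 / (2 * T)) * t = Real.log 2 * (1 - t / (2 * T)) := by ring
      rw [e]
      exact mul_nonneg hl.le (by linarith)
    nlinarith [le_max_left D 1]
  · obtain ⟨m, τ, h1, h2, rfl⟩ := h.exists_nat_mul htT
    refine ((h.iterate h1 h2 m y hw').2 v hv').trans (mul_le_mul_of_nonneg_right ?_ hN)
    have : (1 / 2 : ℝ) ^ m = Real.exp (-(Real.log 2 * m)) := by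
      rw [Real.exp_neg, mul_comm, Real.exp_nat_mul, Real.exp_log (by norm_num)]
      simp
    rw [this]
    have h3 : Real.exp (-(Real.log 2 * m)) ≤
        Real.exp (Real.log 2 + -(Real.log 2 / (2 * T)) * (m * τ)) := by
      apply Real.exp_le_exp.2
      have : τ / (2 * T) ≤ 1 := by rw [div_le_one (by positivity)]; linarith
      have e : Real.log 2 + -(Real.log 2 / (2 * T)) * (m * τ) =
        Real.log 2 - Real.log 2 * m * (τ / (2 * T)) := by ring
      rw [e]
      have : Real.log 2 * m * (τ / (2 * T)) ≤ Real.log 2 * m :=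
        mul_le_of_le_one_right (by positivity) this
      linarith
    nlinarith [Real.exp_pos (Real.log 2 + -(Real.log 2 / (2 * T)) * (m * τ))]

end ConeDomination

/-! ### Comparison of seminorms with a fixed norm over compact sets -/

section Seminorms

variable {Y K V : Type*} [TopologicalSpace Y] [RCLike K] [NormedAddCommGroup V] [NormedSpace K V]

theorem Seminorm.eq_norm_mul (p : Seminorm K V) (x : V) :
    ∃ u : V, (x ≠ 0 → ‖u‖ = 1) ∧ p x = ‖x‖ * p u := by
  by_cases hx : x = 0
  · exact ⟨0, fun h => (h hx).elim, by simp [hx]⟩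
  · have hn : ‖x‖ ≠ 0 := by simpa using hx
    refine ⟨((‖x‖ : ℝ) : K)⁻¹ • x, fun _ => ?_, ?_⟩
    · rw [norm_smul, norm_inv, RCLike.norm_ofReal, abs_of_nonneg (norm_nonneg _),
        inv_mul_cancel₀ hn]
    · rw [map_smul_eq_mul, norm_inv, RCLike.norm_ofReal, abs_of_nonneg (norm_nonneg _),
        mul_inv_cancel_left₀ hn]

theorem Seminorm.mul_norm_le_of_sphere (p : Seminorm K V) {c : ℝ}
    (h : ∀ u ∈ Metric.sphere (0 : V) 1, c ≤ p u) (x : V) : c * ‖x‖ ≤ p x := by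
  by_cases hx : x = 0
  · simp [hx]
  obtain ⟨u, hu, e⟩ := Seminorm.eq_norm_mul p x
  rw [e, mul_comm]
  exact mul_le_mul_of_nonneg_left (h u (by simpa using hu hx)) (norm_nonneg _)

theorem Seminorm.le_mul_norm_of_sphere (p : Seminorm K V) {c : ℝ}
    (h : ∀ u ∈ Metric.sphere (0 : V) 1, p u ≤ c) (x : V) : p x ≤ c * ‖x‖ := by
  by_cases hx : x = 0
  · simp [hx]
  obtain ⟨u, hu, e⟩ := Seminorm.eq_norm_mul p x
  rw [e, mul_comm]
  exact mul_le_mul_of_nonneg_right (h u (by simpa using hu hx)) (norm_nonneg _)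

theorem exists_mul_norm_le_of_isCompact [FiniteDimensional K V] {n : Y → Seminorm K V}
    (hn : Continuous fun p : Y × V => n p.1 p.2) (hdef : ∀ y v, n y v = 0 → v = 0) {L : Set Y}
    (hL : IsCompact L) : ∃ c > 0, ∀ y ∈ L, ∀ x, c * ‖x‖ ≤ n y x := by
  have := FiniteDimensional.proper_rclike K V
  rcases (L ×ˢ Metric.sphere (0 : V) 1).eq_empty_or_nonempty with he | hne
  -- If `L` is empty or the unit sphere is empty, any positive constant serves.
  · refine ⟨1, one_pos, fun y hy x => Seminorm.mul_norm_le_of_sphere _ (fun u hu => ?_) x⟩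
    have : (y, u) ∈ L ×ˢ Metric.sphere (0 : V) 1 := ⟨hy, hu⟩
    rw [he] at this
    exact this.elim
  · obtain ⟨⟨y₀, u₀⟩, ⟨_, h2⟩, h⟩ := (hL.prod (isCompact_sphere (0 : V) 1)).exists_isMinOn hne
      hn.continuousOn
    refine ⟨n y₀ u₀, ?_, fun y hy x => Seminorm.mul_norm_le_of_sphere _ (fun u hu => ?_) x⟩
    · refine (apply_nonneg _ _).lt_of_ne fun h0 => ?_
      have := hdef _ _ h0.symm
      simp [this] at h2
    · exact h (a := (y, u)) ⟨hy, hu⟩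

theorem exists_le_mul_norm_of_isCompact [FiniteDimensional K V] {n : Y → Seminorm K V}
    (hn : Continuous fun p : Y × V => n p.1 p.2) {L : Set Y}
    (hL : IsCompact L) : ∃ c > 0, ∀ y ∈ L, ∀ x, n y x ≤ c * ‖x‖ := by
  have := FiniteDimensional.proper_rclike K V
  obtain ⟨c, hc⟩ := (hL.prod (isCompact_sphere (0 : V) 1)).bddAbove_image hn.continuousOn
  refine ⟨max c 1, by positivity, fun y hy x => Seminorm.le_mul_norm_of_sphere _ (fun u hu => ?_) x⟩
  exact (hc ⟨(y, u), ⟨hy, hu⟩, rfl⟩).trans (le_max_left _ _)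

theorem eventually_mul_norm_le [FiniteDimensional K V] {n : Y → Seminorm K V}
    (hn : Continuous fun p : Y × V => n p.1 p.2) (hdef : ∀ y v, n y v = 0 → v = 0) (y₀ : Y) :
    ∃ c > 0, ∀ᶠ y in 𝓝 y₀, ∀ x, c * ‖x‖ ≤ n y x := by
  have := FiniteDimensional.proper_rclike K V
  obtain ⟨c, hc, h⟩ := exists_mul_norm_le_of_isCompact hn hdef (isCompact_singleton (x := y₀))
  refine ⟨c / 2, by positivity, ?_⟩
  have : ∀ᶠ y in 𝓝 y₀, ∀ u ∈ Metric.sphere (0 : V) 1, c / 2 < n y u := by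
    refine (isCompact_sphere (0 : V) 1).eventually_forall_of_forall_eventually fun u hu => ?_
    refine hn.continuousAt.eventually (lt_mem_nhds ?_)
    have := h y₀ rfl u
    have hu' : ‖u‖ = 1 := by simpa using hu
    rw [hu'] at this
    simp only
    linarith
  filter_upwards [this] with y hy x
  exact Seminorm.mul_norm_le_of_sphere _ (fun u hu => (hy u hu).le) x

end Seminorms

/-! ### Rank and continuity of the invariant bundle -/

namespace ConeDomination

variable {Y K V : Type*} [TopologicalSpace Y] [RCLike K] [NormedAddCommGroup V]
  [NormedSpace K V] {φ : Flow ℝ Y} {a b : Y → Seminorm K V} {T : ℝ}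

theorem continuous_add (h : ConeDomination φ a b T) :
    Continuous fun p : Y × V => (a p.1 + b p.1) p.2 :=
  h.continuous_left.add h.continuous_right

theorem eq_zero_of_add_eq_zero (h : ConeDomination φ a b T) (y : Y) (v : V)
    (hv : (a y + b y) v = 0) : v = 0 :=
  h.eq_zero_of_add_nonpos hv.le

variable [FiniteDimensional K V]

/-- The spaces `Fu` taken far in the past lie in the cone there and remain transverse to `Fs y` when
followed to `y`. Decomposing `v` along them gives a bounded sequence, and a limit point lies in the
cone at every time `-jT`, hence along the whole orbit. -/
theorem exists_mem_bundle (h : ConeDomination φ a b T) {Fs Fu : Y → Submodule K V}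
    (hs : ∀ y v, v ∈ Fs y ↔ b y v = 0) (hu : ∀ y v, v ∈ Fu y ↔ a y v = 0)
    (hr : ∀ y z, Module.finrank K (Fu z) + Module.finrank K (Fs y) = Module.finrank K V) (y : Y)
    (v : V) : ∃ x ∈ h.bundle y, v - x ∈ Fs y := by
  have := FiniteDimensional.proper_rclike K V
  have hT := h.pos
  have back (m j : ℕ) (hj : j < m) (x : V) (hx : a (φ (-(m * T)) y) x ≤ b (φ (-(m * T)) y) x) :
      a (φ (-(j * T)) y) x ≤ b (φ (-(j * T)) y) x := by
    have e : φ (-(j * T)) y = φ (((m : ℝ) - j) * T) (φ (-(m * T)) y) := by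
      rw [← Flow.map_add]; congr 1; ring
    rw [e]
    refine h.cone_forward ?_ hx
    have : (j : ℝ) + 1 ≤ m := by exact_mod_cast hj
    nlinarith
  have ex (m : ℕ) : ∃ x, (∀ j ≤ m, a (φ (-(j * T)) y) x ≤ b (φ (-(j * T)) y) x) ∧
      v - x ∈ Fs y := by
    -- Starting one step earlier, at `-(m+1)T`, leaves at least time `T` before each time `-jT` with
    -- `j ≤ m`, as forward invariance requires.
    have top : Fu (φ (-((m + 1 : ℕ) * T)) y) ⊔ Fs y = ⊤ := by
      refine Submodule.eq_top_of_disjoint _ _ (hr _ _).ge ?_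
      rw [Submodule.disjoint_def]
      intro x hx hx'
      rw [hu] at hx
      rw [hs] at hx'
      have := back (m + 1) 0 (by omega) x (by rw [hx]; exact apply_nonneg _ _)
      simp only [Nat.cast_zero, zero_mul, neg_zero, Flow.map_zero_apply, hx'] at this
      exact h.definite y x (this.antisymm (apply_nonneg _ _)) hx'
    obtain ⟨x, hx, z, hz, e⟩ := Submodule.mem_sup.1 (top ▸ Submodule.mem_top : v ∈ _)
    refine ⟨x, fun j hj => back (m + 1) j (by omega) x ?_, ?_⟩
    · rw [(hu _ _).1 hx]; exact apply_nonneg _ _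
    · rw [← e, add_sub_cancel_left]; exact hz
  choose x hx hx' using ex
  have bsub (x : V) (hx : v - x ∈ Fs y) : b y x ≤ b y v := by
    have h1 := map_sub_le_add (b y) v (v - x)
    rw [(hs _ _).1 hx, sub_sub_cancel] at h1
    linarith
  obtain ⟨c, hc, hcn⟩ := eventually_mul_norm_le h.continuous_add h.eq_zero_of_add_eq_zero y
  have hcy := hcn.self_of_nhds
  have hball (m : ℕ) : x m ∈ Metric.closedBall (0 : V) (2 * b y v / c) := by
    rw [mem_closedBall_zero_iff, le_div_iff₀ hc]
    have h1 := hcy (x m)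
    have h2 := hx m 0 (Nat.zero_le _)
    have h3 := bsub _ (hx' m)
    simp only [Nat.cast_zero, zero_mul, neg_zero, Flow.map_zero_apply] at h2
    rw [add_apply] at h1
    linarith
  obtain ⟨z, -, σ, hσ, hz⟩ := (isCompact_closedBall (0 : V) (2 * b y v / c)).tendsto_subseq hball
  refine ⟨z, fun t => h.forall_mem_cone (fun j => ?_) t, ?_⟩
  · refine le_of_tendsto_of_tendsto
      ((h.continuous_left.comp (Continuous.prodMk_right (φ (-(j * T)) y))).tendsto z |>.comp hz)
      ((h.continuous_right.comp (Continuous.prodMk_right (φ (-(j * T)) y))).tendsto z |>.comp hz) ?_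
    filter_upwards [eventually_ge_atTop j] with m hm
    exact hx _ j (hm.trans (hσ.id_le m))
  · rw [hs]
    have h1 : Tendsto (fun m => b y (v - x (σ m))) atTop (𝓝 (b y (v - z))) :=
      ((h.continuous_right.comp (Continuous.prodMk_right y)).tendsto (v - z)).comp
        (tendsto_const_nhds.sub hz)
    refine tendsto_nhds_unique h1 ?_
    simp only [(hs _ _).1 (hx' _)]
    exact tendsto_const_nhds

theorem isCompl_bundle_ker (h : ConeDomination φ a b T) {Fs Fu : Y → Submodule K V}
    (hs : ∀ y v, v ∈ Fs y ↔ b y v = 0) (hu : ∀ y v, v ∈ Fu y ↔ a y v = 0)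
    (hr : ∀ y z, Module.finrank K (Fu z) + Module.finrank K (Fs y) = Module.finrank K V) (y : Y) :
    IsCompl (h.bundle y) (Fs y) := by
  refine ⟨?_, ?_⟩
  · rw [Submodule.disjoint_def]
    intro x hx hx'
    rw [hs] at hx'
    have := h.le_of_mem_bundle hx
    exact h.definite y x (le_antisymm (by linarith) (apply_nonneg _ _)) hx'
  · rw [codisjoint_iff, Submodule.eq_top_iff']
    intro v
    obtain ⟨x, hx, hx'⟩ := h.exists_mem_bundle hs hu hr y v
    exact Submodule.mem_sup.2 ⟨x, hx, v - x, hx', by abel⟩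

theorem finrank_bundle (h : ConeDomination φ a b T) {Fs Fu : Y → Submodule K V}
    (hs : ∀ y v, v ∈ Fs y ↔ b y v = 0) (hu : ∀ y v, v ∈ Fu y ↔ a y v = 0)
    (hr : ∀ y z, Module.finrank K (Fu z) + Module.finrank K (Fs y) = Module.finrank K V) (y : Y) :
    Module.finrank K (h.bundle y) = Module.finrank K (Fu y) := by
  have h1 := Submodule.finrank_add_eq_of_isCompl (h.isCompl_bundle_ker hs hu hr y)
  have h2 := hr y y
  omega

/-- A closed graph argument: the projections are locally bounded, and each limit point still
decomposes `v` along the complementary pair at `y₀`, which determines it. Ultrafilters are used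
because `Y` need not be first countable. -/
theorem continuous_projection (h : ConeDomination φ a b T) {Fs : Y → Submodule K V}
    (hs : ∀ y v, v ∈ Fs y ↔ b y v = 0) (hc : ∀ y, IsCompl (h.bundle y) (Fs y)) (v : V) :
    Continuous fun y => (h.bundle y).projection (Fs y) (hc y) v := by
  have := FiniteDimensional.proper_rclike K V
  rw [continuous_iff_continuousAt]
  intro y₀
  set R := fun y => (h.bundle y).projection (Fs y) (hc y) v
  have hR1 (y : Y) : R y ∈ h.bundle y := Submodule.projection_apply_mem _ _
  have hR2 (y : Y) : v - R y ∈ Fs y := Submodule.sub_projection_mem _ _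
  obtain ⟨c, hc0, hcn⟩ := eventually_mul_norm_le h.continuous_add h.eq_zero_of_add_eq_zero y₀
  have hbv : Continuous fun y => b y v := h.continuous_right.comp (Continuous.prodMk_left v)
  have hbd : ∀ᶠ y in 𝓝 y₀, R y ∈ Metric.closedBall (0 : V) (2 * (b y₀ v + 1) / c) := by
    filter_upwards [hcn, hbv.continuousAt.eventually (gt_mem_nhds (lt_add_one (b y₀ v)))]
      with y hy1 hy2
    rw [mem_closedBall_zero_iff, le_div_iff₀ hc0]
    have h1 := map_sub_le_add (b y) v (v - R y)
    rw [(hs _ _).1 (hR2 y), sub_sub_cancel] at h1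
    have h2 := h.le_of_mem_bundle (hR1 y)
    have h3 := hy1 (R y)
    rw [add_apply] at h3
    linarith
  change Tendsto R (𝓝 y₀) (𝓝 (R y₀))
  rw [tendsto_iff_ultrafilter]
  intro g hg
  obtain ⟨x, -, hx⟩ := (isCompact_closedBall (0 : V) (2 * (b y₀ v + 1) / c)).ultrafilter_le_nhds
    (g.map R) (le_principal_iff.2 (hg hbd))
  have hx : Tendsto R g (𝓝 x) := hx
  have m1 : x ∈ h.bundle y₀ := by
    have : Tendsto (fun y => (y, R y)) g (𝓝 (y₀, x)) := Tendsto.prodMk_nhds hg hx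
    exact h.isClosed_bundle.mem_of_tendsto this (Eventually.of_forall hR1)
  have m2 : v - x ∈ Fs y₀ := by
    rw [hs]
    have h1 : Tendsto (fun y => b y (v - R y)) g (𝓝 (b y₀ (v - x))) :=
      (h.continuous_right.tendsto (y₀, v - x)).comp
        (Tendsto.prodMk_nhds hg (tendsto_const_nhds.sub hx))
    refine tendsto_nhds_unique h1 ?_
    simp only [(hs _ _).1 (hR2 _)]
    exact tendsto_const_nhds
  have m3 : x = R y₀ := by
    rw [← sub_eq_zero]
    refine (Submodule.disjoint_def.1 (hc y₀).disjoint) _ (sub_mem m1 (hR1 y₀)) ?_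
    have := sub_mem (hR2 y₀) m2
    rwa [sub_sub_sub_cancel_left] at this
  rwa [m3] at hx

end ConeDomination

/-! ### Subbundles and continuous projections -/

/-- The range of a continuous family of projections of constant rank is a subbundle. -/
theorem isSubbundle_of_continuous {Y K : Type*} [TopologicalSpace Y] [RCLike K] {d r : ℕ}
    {E : Y → Submodule K (Fin d → K)} (R : Y → (Fin d → K) →ₗ[K] (Fin d → K))
    (hR : ∀ v, Continuous fun y => R y v) (hmem : ∀ y v, R y v ∈ E y)
    (hfix : ∀ y, ∀ v ∈ E y, R y v = v) (hr : ∀ y, Module.finrank K (E y) = r) :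
    IsSubbundle r E := by
  intro y₀
  let e := Module.finBasisOfFinrankEq K (E y₀) (hr y₀)
  -- Projecting a basis of the fibre at `y₀` to nearby fibres gives the local frame, since linear
  -- independence is an open condition.
  have hopen : ∀ᶠ y in 𝓝 y₀, LinearIndependent K fun i => R y (e i : Fin d → K) := by
    have hcont : Continuous fun y => fun i => R y (e i : Fin d → K) :=
      continuous_pi fun i => hR _
    refine hcont.continuousAt.eventually (isOpen_setOfPred_linearIndependent.mem_nhds ?_)
    have : (fun i => R y₀ (e i : Fin d → K)) = fun i => (e i : Fin d → K) := by
      ext1 i; exact hfix y₀ _ (e i).2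
    change LinearIndependent K fun i => R y₀ (e i : Fin d → K)
    rw [this]
    exact e.linearIndependent.map' (E y₀).subtype (Submodule.ker_subtype _)
  refine ⟨_, hopen, fun i y => R y (e i), fun i => (hR _).continuousOn, fun y hy => ⟨hy, ?_⟩⟩
  refine Submodule.eq_of_le_of_finrank_eq ?_ ?_
  · rw [Submodule.span_le]
    rintro _ ⟨i, rfl⟩
    exact hmem _ _
  · rw [finrank_span_eq_card hy, hr, Fintype.card_fin]

theorem IsSubbundle.finrank_eq {Y K : Type*} [TopologicalSpace Y] [RCLike K] {d r : ℕ}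
    {E : Y → Submodule K (Fin d → K)} (h : IsSubbundle r E) (y : Y) :
    Module.finrank K (E y) = r := by
  obtain ⟨U, hU, s, -, h⟩ := h y
  obtain ⟨h1, h2⟩ := h y (mem_of_mem_nhds hU)
  rw [← h2, finrank_span_eq_card h1, Fintype.card_fin]

/-- Local frames of the two bundles together form an invertible operator depending continuously on
`y`. Its inverse yields the coefficients of `v`, and the projection keeps those along the first
frame. -/
theorem IsSubbundle.continuous_projection {Y K : Type*} [TopologicalSpace Y] [RCLike K]
    {d r s : ℕ} {E F : Y → Submodule K (Fin d → K)} (hE : IsSubbundle r E) (hF : IsSubbundle s F)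
    (hc : ∀ y, IsCompl (E y) (F y)) (v : Fin d → K) :
    Continuous fun y => (E y).projection (F y) (hc y) v := by
  rw [continuous_iff_continuousAt]
  intro y₀
  obtain ⟨U, hU, e, he, hE'⟩ := hE y₀
  obtain ⟨U', hU', f, hf, hF'⟩ := hF y₀
  let ef : Y → Fin r ⊕ Fin s → (Fin d → K) := fun y => Sum.elim (fun i => e i y) (fun j => f j y)
  let A : Y → (Fin r ⊕ Fin s → K) →L[K] (Fin d → K) := fun y =>
    LinearMap.toContinuousLinearMap (Fintype.linearCombination K (ef y))
  have hA (y : Y) (c : Fin r ⊕ Fin s → K) :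
      A y c = (∑ i, c (.inl i) • e i y) + ∑ j, c (.inr j) • f j y := by
    simp [A, ef, Fintype.linearCombination_apply]
  have hAc : ContinuousAt A y₀ := by
    rw [continuousAt_clm_apply]
    intro c
    simp only [hA]
    refine ContinuousAt.add ?_ ?_ <;>
      refine tendsto_finsetSum _ fun i _ => Tendsto.smul tendsto_const_nhds ?_
    · exact (he i).continuousAt hU
    · exact (hf i).continuousAt hU'
  have hinv (y : Y) (hy : y ∈ U) (hy' : y ∈ U') :
      ∃ Φ : (Fin r ⊕ Fin s → K) ≃L[K] (Fin d → K), (Φ : _ →L[K] _) = A y := by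
    have hli : LinearIndependent K (ef y) := by
      refine (hE' y hy).1.sum_type (hF' y hy').1 ?_
      rw [(hE' y hy).2, (hF' y hy').2]
      exact (hc y).disjoint
    have hsp : LinearMap.range (Fintype.linearCombination K (ef y)) = ⊤ := by
      rw [Fintype.range_linearCombination, Set.Sum.elim_range, Submodule.span_union,
        (hE' y hy).2, (hF' y hy').2]
      exact (hc y).sup_eq_top
    exact ⟨(LinearEquiv.ofBijective (Fintype.linearCombination K (ef y))
      ⟨hli.fintypeLinearCombination_injective,
        LinearMap.range_eq_top.1 hsp⟩).toContinuousLinearEquiv, rfl⟩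
  obtain ⟨Φ₀, hΦ₀⟩ := hinv y₀ (mem_of_mem_nhds hU) (mem_of_mem_nhds hU')
  have hinvc : ContinuousAt (fun y => (A y).inverse) y₀ := by
    have h1 : ContinuousAt ContinuousLinearMap.inverse (A y₀) := by
      rw [← hΦ₀]
      exact (contDiffAt_map_inverse (n := 0) Φ₀).continuousAt
    exact h1.comp hAc
  have hcoef : ContinuousAt (fun y => (A y).inverse v) y₀ :=
    (continuousAt_clm_apply.1 hinvc) v
  have hlim : ContinuousAt (fun y => ∑ i, (A y).inverse v (.inl i) • e i y) y₀ := by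
    refine tendsto_finsetSum _ fun i _ => Tendsto.smul ?_ ((he i).continuousAt hU)
    exact (continuousAt_pi.1 hcoef) (.inl i)
  refine hlim.congr ?_
  filter_upwards [hU, hU'] with y hy hy'
  obtain ⟨Φ, hΦ⟩ := hinv y hy hy'
  have hv : A y ((A y).inverse v) = v := by
    rw [← hΦ, ContinuousLinearMap.inverse_equiv]
    simp
  set c := (A y).inverse v
  rw [hA] at hv
  have m1 : ∑ i, c (.inl i) • e i y ∈ E y := by
    rw [← (hE' y hy).2]
    exact Submodule.sum_mem _ fun i _ => Submodule.smul_mem _ _ (Submodule.subset_span ⟨i, rfl⟩)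
  have m2 : ∑ j, c (.inr j) • f j y ∈ F y := by
    rw [← (hF' y hy').2]
    exact Submodule.sum_mem _ fun i _ => Submodule.smul_mem _ _ (Submodule.subset_span ⟨i, rfl⟩)
  conv_rhs => rw [← hv]
  rw [map_add, Submodule.projection_apply_of_mem_left _ m1,
    (Submodule.projection_apply_eq_zero_iff _).2 m2, add_zero]

/-! ### Cocompact properly discontinuous actions: local compactness and cutoffs -/

section Topology

variable {Γ Y : Type*} [Group Γ] [TopologicalSpace Y] [MulAction Γ Y]

theorem exists_finset_smul_mem [ContinuousConstSMul Γ Y]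
    [CompactSpace (Quotient (MulAction.orbitRel Γ Y))] (U : Y → Set Y) (hU : ∀ x, U x ∈ 𝓝 x) :
    ∃ t : Finset Y, ∀ y, ∃ γ : Γ, ∃ x ∈ t, γ • y ∈ U x := by
  let π : Y → Quotient (MulAction.orbitRel Γ Y) := Quotient.mk _
  have hπ : IsOpenMap π := isOpenMap_quotient_mk'_mul
  choose s hs using fun q : Quotient (MulAction.orbitRel Γ Y) => Quotient.exists_rep q
  obtain ⟨t, ht⟩ := isCompact_univ.elim_nhds_subcover (fun q => π '' U (s q)) (fun q _ => by
    have := hπ.image_mem_nhds (hU (s q))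
    rwa [show π (s q) = q from hs q] at this)
  classical
  refine ⟨t.image s, fun y => ?_⟩
  obtain ⟨q, hq, z, hz, e⟩ := Set.mem_iUnion₂.1 (ht.2 (Set.mem_univ (π y)))
  obtain ⟨γ, hγ⟩ := Quotient.exact e
  exact ⟨γ, s q, Finset.mem_image_of_mem _ hq, by simpa only [hγ] using hz⟩

/-- An ultrafilter on `closure W` converges in the compact quotient, to the class of some `z`.
Proper discontinuity leaves only finitely many translates of a neighbourhood of `z` that meet
`closure W`, so the ultrafilter must converge to one of the corresponding translates of `z`. -/
theorem IsProperlyDiscontinuous.weaklyLocallyCompactSpace [ContinuousConstSMul Γ Y]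
    [CompactSpace (Quotient (MulAction.orbitRel Γ Y))] (h : IsProperlyDiscontinuous Γ Y) :
    WeaklyLocallyCompactSpace Y := by
  refine ⟨fun x => ?_⟩
  let π : Y → Quotient (MulAction.orbitRel Γ Y) := Quotient.mk _
  have hπ : IsOpenMap π := isOpenMap_quotient_mk'_mul
  choose U hU V hV hfin using fun z : Y => h z x
  obtain ⟨t, ht⟩ := exists_finset_smul_mem (Γ := Γ) (fun z => interior (U z))
    (fun z => interior_mem_nhds.2 (hU z))
  set W : Set Y := ⋂ z ∈ t, V z
  have hW : W ∈ 𝓝 x := (biInter_finset_mem t).2 fun z _ => hV z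
  set S : Set Γ := ⋃ z ∈ t, {γ : Γ | (((fun y : Y => γ • y) '' U z) ∩ V z).Nonempty}
  have hS : S.Finite := t.finite_toSet.biUnion fun z _ => hfin z
  -- A translate of an open set that contains a point of `closure W` meets `W` itself, so passing to
  -- the closure adds no group elements.
  have mem_S {z : Y} (hz : z ∈ t) {n : Y} (hn : n ∈ interior (U z)) {γ : Γ}
      (hγ : γ • n ∈ closure W) : γ ∈ S := by
    have ho : IsOpen ((fun y : Y => γ • y) '' interior (U z)) :=
      (isOpenMap_smul γ) _ isOpen_interior
    obtain ⟨_, ⟨m, hm, rfl⟩, hm'⟩ := mem_closure_iff.1 hγ _ ho ⟨n, hn, rfl⟩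
    exact Set.mem_biUnion hz ⟨γ • m, ⟨m, interior_subset hm, rfl⟩, Set.mem_iInter₂.1 hm' z hz⟩
  refine ⟨closure W, ?_, mem_of_superset hW subset_closure⟩
  rw [isCompact_iff_ultrafilter_le_nhds']
  intro f hf
  obtain ⟨q, -, hq⟩ := isCompact_univ.ultrafilter_le_nhds (f.map π) (by simp)
  obtain ⟨z₀, rfl⟩ := Quotient.exists_rep q
  obtain ⟨γ₀, i, hi, hz⟩ := ht z₀
  set z := γ₀ • z₀
  have hzq : π z = Quotient.mk _ z₀ := Quotient.sound ⟨γ₀, rfl⟩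
  rw [← hzq] at hq
  suffices ∃ γ ∈ S, (f : Filter Y) ≤ 𝓝 (γ • z) by
    obtain ⟨γ, -, hγ⟩ := this
    exact ⟨γ • z, isClosed_closure.mem_of_tendsto (f := id) hγ hf, hγ⟩
  by_contra! hcon
  have hcon' : ∀ γ ∈ S, ∃ N ∈ 𝓝 (γ • z), N ∉ f := by
    intro γ hγ
    have := hcon γ hγ
    rw [Filter.le_def] at this
    push Not at this
    exact this
  choose! N hN hNf using hcon'
  set M : Set Y := interior (U i) ∩ ⋂ γ ∈ S, (fun y : Y => γ • y) ⁻¹' N γ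
  have hM : M ∈ 𝓝 z := by
    refine inter_mem (isOpen_interior.mem_nhds hz) ((biInter_mem hS).2 fun γ hγ => ?_)
    exact (continuous_const_smul γ).continuousAt (hN γ hγ)
  have h1 : π ⁻¹' (π '' M) ∈ f := hq (hπ.image_mem_nhds hM)
  have h2 : (⋃ γ ∈ S, N γ) ∈ f := by
    refine mem_of_superset (inter_mem h1 hf) ?_
    rintro y ⟨⟨m, hm, e⟩, hy⟩
    obtain ⟨γ, hγ⟩ := Quotient.exact e.symm
    have hγ : γ • m = y := hγ
    rw [← hγ] at hy ⊢
    have hγS := mem_S hi hm.1 hy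
    exact Set.mem_biUnion hγS (Set.mem_iInter₂.1 hm.2 γ hγS)
  obtain ⟨γ, hγ, hγf⟩ := (Ultrafilter.finite_biUnion_mem_iff hS).1 h2
  exact hNf γ hγ hγf

theorem exists_isCompact_forall_smul_mem [ContinuousConstSMul Γ Y] [WeaklyLocallyCompactSpace Y]
    [CompactSpace (Quotient (MulAction.orbitRel Γ Y))] :
    ∃ C : Set Y, IsCompact C ∧ ∀ y, ∃ γ : Γ, γ • y ∈ C := by
  choose U hU hU' using fun x : Y => exists_compact_mem_nhds x
  obtain ⟨t, ht⟩ := exists_finset_smul_mem (Γ := Γ) U hU'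
  refine ⟨⋃ x ∈ t, U x, t.isCompact_biUnion fun x _ => hU x, fun y => ?_⟩
  obtain ⟨γ, x, hx, h⟩ := ht y
  exact ⟨γ, Set.mem_biUnion hx h⟩

theorem IsProperlyDiscontinuous.finite_of_isCompact (h : IsProperlyDiscontinuous Γ Y) {A B : Set Y}
    (hA : IsCompact A) (hB : IsCompact B) : {γ : Γ | ∃ y ∈ A, γ • y ∈ B}.Finite := by
  have : {γ : Γ | ∃ p ∈ A ×ˢ B, γ • p.1 = p.2}.Finite := by
    refine (hA.prod hB).induction_on (p := fun s => {γ : Γ | ∃ p ∈ s, γ • p.1 = p.2}.Finite)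
      (by simp) ?_ ?_ ?_
    · exact fun s t hst ht => ht.subset fun γ ⟨p, hp, e⟩ => ⟨p, hst hp, e⟩
    · intro s t hs ht
      refine (hs.union ht).subset ?_
      rintro γ ⟨p, hp | hp, e⟩
      · exact Or.inl ⟨p, hp, e⟩
      · exact Or.inr ⟨p, hp, e⟩
    · rintro ⟨x, y⟩ -
      obtain ⟨U, hU, V, hV, hf⟩ := h x y
      refine ⟨U ×ˢ V, mem_nhdsWithin_of_mem_nhds (prod_mem_nhds hU hV), hf.subset ?_⟩
      rintro γ ⟨p, hp, e⟩
      exact ⟨γ • p.1, ⟨p.1, hp.1, rfl⟩, by rw [e]; exact hp.2⟩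
  refine this.subset ?_
  rintro γ ⟨y, hy, hy'⟩
  exact ⟨(y, γ • y), ⟨hy, hy'⟩, rfl⟩

theorem IsProperlyDiscontinuous.finite_support (h : IsProperlyDiscontinuous Γ Y) {χ : Y → ℝ}
    (hχ : HasCompactSupport χ) {A : Set Y} (hA : IsCompact A) :
    {γ : Γ | ∃ y ∈ A, χ (γ⁻¹ • y) ≠ 0}.Finite := by
  refine (h.finite_of_isCompact hχ.isCompact hA).subset ?_
  rintro γ ⟨y, hy, hy'⟩
  exact ⟨γ⁻¹ • y, subset_tsupport _ hy', by simpa using hy⟩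

theorem IsProperlyDiscontinuous.locallyFinite_support [WeaklyLocallyCompactSpace Y]
    (h : IsProperlyDiscontinuous Γ Y) {χ : Y → ℝ} (hχ : HasCompactSupport χ) :
    LocallyFinite fun γ : Γ => Function.support fun y => χ (γ⁻¹ • y) := by
  intro x
  obtain ⟨C, hC, hx⟩ := exists_compact_mem_nhds x
  refine ⟨C, hx, (h.finite_support hχ hC).subset ?_⟩
  rintro γ ⟨y, hy, hy'⟩
  exact ⟨y, hy', hy⟩

/-- A bump function equal to 1 on a compact set meeting every orbit is divided by its orbit sum,
which is continuous, invariant and positive. -/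
theorem IsProperlyDiscontinuous.exists_cutoff [ContinuousConstSMul Γ Y] [T2Space Y]
    [CompactSpace (Quotient (MulAction.orbitRel Γ Y))] (h : IsProperlyDiscontinuous Γ Y) :
    ∃ χ : Y → ℝ, Continuous χ ∧ (∀ y, 0 ≤ χ y) ∧ HasCompactSupport χ ∧
      ∀ y, ∑ᶠ γ : Γ, χ (γ⁻¹ • y) = 1 := by
  have := h.weaklyLocallyCompactSpace
  obtain ⟨C, hC, hcov⟩ := exists_isCompact_forall_smul_mem (Γ := Γ) (Y := Y)
  obtain ⟨f, hf1, -, hfc, hf01⟩ := exists_continuous_one_zero_of_isCompact hC isClosed_empty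
    (Set.disjoint_empty C)
  set S : Y → ℝ := fun y => ∑ᶠ γ : Γ, f (γ⁻¹ • y)
  have hS : Continuous S := continuous_finsum
    (fun γ => f.continuous.comp (continuous_const_smul _)) (h.locallyFinite_support hfc)
  have hfs (y : Y) : (Function.support fun γ : Γ => f (γ⁻¹ • y)).Finite := by
    refine (h.finite_support hfc (isCompact_singleton (x := y))).subset fun γ hγ => ?_
    exact ⟨y, rfl, hγ⟩
  have hpos (y : Y) : 0 < S y := by
    obtain ⟨γ, hγ⟩ := hcov y
    refine finsum_pos (fun i => (hf01 _).1) ⟨γ⁻¹, ?_⟩ (hfs y)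
    rw [inv_inv, hf1 hγ]
    exact one_pos
  have hinv (δ : Γ) (y : Y) : S (δ • y) = S y := by
    refine finsum_eq_of_bijective (fun γ => δ⁻¹ * γ) (Group.mulLeft_bijective δ⁻¹) fun γ => ?_
    simp [mul_smul]
  refine ⟨fun y => f y / S y, f.continuous.div hS fun y => (hpos y).ne',
    fun y => div_nonneg (hf01 _).1 (hpos y).le, ?_, fun y => ?_⟩
  · refine hfc.mono fun y hy => ?_
    rw [Function.mem_support] at hy ⊢
    exact fun h0 => hy (by simp [h0])
  · simp only [hinv, div_eq_mul_inv]
    rw [← finsum_mul]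
    exact mul_inv_cancel₀ (hpos y).ne'

end Topology

/-! ### Averaged intertwiners of flat bundles -/

section Intertwiner

variable {Γ Y K : Type*} [Group Γ] [MulAction Γ Y] [RCLike K] {d : ℕ}

/-- The average of the matrices `ρ γ * (ρ₀ γ)⁻¹` with weights given by a cutoff function; it
intertwines the flat bundles of `ρ₀` and `ρ`. -/
noncomputable def intertwiner (χ : Y → ℝ) (ρ₀ ρ : Γ →* Matrix.SpecialLinearGroup (Fin d) K)
    (y : Y) : Matrix (Fin d) (Fin d) K :=
  ∑ᶠ γ : Γ, (χ (γ⁻¹ • y) : K) • (ρ γ * (ρ₀ γ)⁻¹).1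

theorem intertwiner_eq_sum {χ : Y → ℝ} (ρ₀ ρ : Γ →* Matrix.SpecialLinearGroup (Fin d) K)
    {y : Y} {s : Finset Γ} (hs : ∀ γ, χ (γ⁻¹ • y) ≠ 0 → γ ∈ s) :
    intertwiner χ ρ₀ ρ y = ∑ γ ∈ s, (χ (γ⁻¹ • y) : K) • (ρ γ * (ρ₀ γ)⁻¹).1 := by
  refine finsum_eq_sum_of_support_subset _ fun γ hγ => hs γ fun h0 => hγ ?_
  simp [h0]

theorem continuous_intertwiner [TopologicalSpace Y] [ContinuousConstSMul Γ Y]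
    [WeaklyLocallyCompactSpace Y] (h : IsProperlyDiscontinuous Γ Y) {χ : Y → ℝ} (hχ : Continuous χ)
    (hχc : HasCompactSupport χ) (ρ₀ ρ : Γ →* Matrix.SpecialLinearGroup (Fin d) K) :
    Continuous (intertwiner χ ρ₀ ρ) := by
  have hl := h.locallyFinite_support hχc
  refine continuous_finsum (fun γ => ?_) (hl.subset fun γ y hy h0 => ?_)
  · have hc : Continuous fun y : Y => (χ (γ⁻¹ • y) : K) :=
      RCLike.continuous_ofReal.comp (hχ.comp (continuous_const_smul γ⁻¹))
    exact hc.smul continuous_const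
  · exact hy (by simp [h0])

/-- Substituting `δ * γ` for `γ` in the sum at `δ • y` brings out `ρ δ` on the left and `(ρ₀ δ)⁻¹`
on the right. -/
theorem intertwiner_smul_mul [TopologicalSpace Y] (h : IsProperlyDiscontinuous Γ Y) {χ : Y → ℝ}
    (hχc : HasCompactSupport χ) (ρ₀ ρ : Γ →* Matrix.SpecialLinearGroup (Fin d) K) (δ : Γ) (y : Y) :
    intertwiner χ ρ₀ ρ (δ • y) * (ρ₀ δ).1 = (ρ δ).1 * intertwiner χ ρ₀ ρ y := by
  classical
  have hfin := (h.finite_support hχc (isCompact_singleton (x := y)))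
  have h1 : ∀ γ, χ (γ⁻¹ • y) ≠ 0 → γ ∈ hfin.toFinset := fun γ hγ => by simpa using hγ
  have h2 : ∀ γ, χ (γ⁻¹ • δ • y) ≠ 0 → γ ∈ hfin.toFinset.image fun γ => δ * γ := fun γ hγ => by
    refine Finset.mem_image.2 ⟨δ⁻¹ * γ, h1 _ ?_, by simp⟩
    simpa [mul_smul] using hγ
  rw [intertwiner_eq_sum ρ₀ ρ h1, intertwiner_eq_sum ρ₀ ρ h2,
    Finset.sum_image (fun _ _ _ _ e => mul_left_cancel e), Finset.sum_mul, Finset.mul_sum]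
  refine Finset.sum_congr rfl fun γ _ => ?_
  rw [Matrix.smul_mul, Matrix.mul_smul, ← Matrix.SpecialLinearGroup.coe_mul,
    ← Matrix.SpecialLinearGroup.coe_mul]
  simp only [map_mul, mul_inv_rev, mul_smul, inv_smul_smul]
  simp [mul_assoc]

theorem eventually_norm_mulVec_sub_le (ρ₀ : Γ →* Matrix.SpecialLinearGroup (Fin d) K) (γ : Γ)
    {η : ℝ} (hη : 0 < η) : ∀ᶠ ρ in @nhds _ (homTopology Γ d K) ρ₀, ∀ x : Fin d → K,
      ‖(ρ γ * (ρ₀ γ)⁻¹).1.mulVec x - x‖ ≤ η * ‖x‖ := by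
  let := homTopology Γ d K
  let f : Matrix (Fin d) (Fin d) K →ₗ[K] ((Fin d → K) →L[K] (Fin d → K)) :=
    LinearMap.toContinuousLinearMap.toLinearMap ∘ₗ Matrix.toLin'.toLinearMap
  have hf : Continuous f := f.continuous_of_finiteDimensional
  have h1 : Continuous fun ρ : Γ →* Matrix.SpecialLinearGroup (Fin d) K => ρ γ :=
    (continuous_apply γ).comp continuous_induced_dom
  have h2 : Continuous fun ρ : Γ →* Matrix.SpecialLinearGroup (Fin d) K =>
      (ρ γ * (ρ₀ γ)⁻¹).1 := by
    simp only [Matrix.SpecialLinearGroup.coe_mul]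
    exact (continuous_subtype_val.comp h1).matrix_mul continuous_const
  have h3 := ((hf.comp h2).sub (continuous_const (y := f 1))).norm.continuousAt (x := ρ₀)
  have h0 : ‖f (ρ₀ γ * (ρ₀ γ)⁻¹).1 - f 1‖ < η := by simpa using hη
  have h4 := h3.eventually (gt_mem_nhds h0)
  filter_upwards [h4] with ρ hρ x
  refine le_trans ?_ (mul_le_mul_of_nonneg_right hρ.le (norm_nonneg x))
  refine le_trans (le_of_eq ?_) (ContinuousLinearMap.le_opNorm _ x)
  simp [f]

/-- Over `L` the intertwiner is a convex combination of finitely many matrices `ρ γ * (ρ₀ γ)⁻¹`,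
each close to the identity. Hence the topology of pointwise convergence suffices. -/
theorem eventually_norm_intertwiner_sub_le [TopologicalSpace Y]
    (h : IsProperlyDiscontinuous Γ Y) {χ : Y → ℝ} (hχ0 : ∀ y, 0 ≤ χ y) (hχc : HasCompactSupport χ)
    (hχ1 : ∀ y, ∑ᶠ γ : Γ, χ (γ⁻¹ • y) = 1) (ρ₀ : Γ →* Matrix.SpecialLinearGroup (Fin d) K)
    {L : Set Y} (hL : IsCompact L) {η : ℝ}
    (hη : 0 < η) : ∀ᶠ ρ in @nhds _ (homTopology Γ d K) ρ₀, ∀ y ∈ L, ∀ x : Fin d → K,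
      ‖(intertwiner χ ρ₀ ρ y).mulVec x - x‖ ≤ η * ‖x‖ := by
  have hfin := h.finite_support hχc hL
  have hev := (Filter.eventually_all_finset hfin.toFinset).2
    fun γ _ => eventually_norm_mulVec_sub_le ρ₀ γ hη
  filter_upwards [hev] with ρ hρ y hy x
  have hs : ∀ γ, χ (γ⁻¹ • y) ≠ 0 → γ ∈ hfin.toFinset := fun γ hγ => by
    simpa using ⟨y, hy, hγ⟩
  have h1 : ∑ γ ∈ hfin.toFinset, χ (γ⁻¹ • y) = 1 := by
    rw [← hχ1 y]
    exact (finsum_eq_sum_of_support_subset _ fun γ hγ => hs γ hγ).symm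
  have h1K : ∑ γ ∈ hfin.toFinset, (χ (γ⁻¹ • y) : K) = 1 := by
    rw [← RCLike.ofReal_sum, h1, RCLike.ofReal_one]
  have e : (intertwiner χ ρ₀ ρ y).mulVec x - x =
      ∑ γ ∈ hfin.toFinset, (χ (γ⁻¹ • y) : K) • ((ρ γ * (ρ₀ γ)⁻¹).1.mulVec x - x) := by
    simp only [smul_sub]
    rw [intertwiner_eq_sum ρ₀ ρ hs, Finset.sum_sub_distrib, ← Finset.sum_smul, h1K, one_smul,
      Matrix.sum_mulVec]
    simp only [Matrix.smul_mulVec]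
  rw [e]
  refine (norm_sum_le _ _).trans ?_
  rw [← one_mul (η * ‖x‖), ← h1, Finset.sum_mul]
  refine Finset.sum_le_sum fun γ hγ => ?_
  rw [norm_smul, RCLike.norm_ofReal, abs_of_nonneg (hχ0 _)]
  exact mul_le_mul_of_nonneg_left (hρ γ hγ x) (hχ0 _)

end Intertwiner

theorem continuous_eval_of_pointwise {Y K V : Type*} [TopologicalSpace Y] [RCLike K]
    [NormedAddCommGroup V] [NormedSpace K V] [FiniteDimensional K V] {P : Y → V →ₗ[K] V}
    (hP : ∀ v, Continuous fun y => P y v) : Continuous fun p : Y × V => P p.1 p.2 := by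
  have h : Continuous fun y => LinearMap.toContinuousLinearMap (P y) :=
    continuous_clm_apply.2 hP
  exact (h.comp continuous_fst).clm_apply continuous_snd

theorem projection_map {K V : Type*} [Field K] [AddCommGroup V] [Module K V]
    {E F E' F' : Submodule K V} (h : IsCompl E F) (h' : IsCompl E' F') (f : V →ₗ[K] V)
    (hE : E' = E.map f) (hF : F' = F.map f) (x : V) :
    E'.projection F' h' (f x) = f (E.projection F h x) := by
  have h1 : f (E.projection F h x) ∈ E' := by
    rw [hE]
    exact Submodule.mem_map_of_mem (Submodule.projection_apply_mem _ _)
  have h2 : f (x - E.projection F h x) ∈ F' := by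
    rw [hF]
    exact Submodule.mem_map_of_mem (Submodule.sub_projection_mem _ _)
  have e : f x = f (E.projection F h x) + f (x - E.projection F h x) := by
    rw [← map_add, add_sub_cancel]
  rw [e, map_add, Submodule.projection_apply_of_mem_left _ h1,
    (Submodule.projection_apply_eq_zero_iff _).2 h2, add_zero]

/-! ### Bundle metrics and uniform estimates by equivariance -/

namespace BundleMetric

variable {Γ Y K : Type*} [Group Γ] [TopologicalSpace Y] [MulAction Γ Y] [RCLike K] {d : ℕ}
  {ρ₀ ρ : Γ →* Matrix.SpecialLinearGroup (Fin d) K}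

/-- The Hermitian form of a bundle metric on a fibre. -/
@[reducible] def core (m : BundleMetric (Y := Y) ρ) (y : Y) :
    PreInnerProductSpace.Core K (Fin d → K) where
  inner v w := star v ⬝ᵥ (m.gram y).mulVec w
  conj_inner_symm v w := by
    rw [starRingEnd_apply, Matrix.star_dotProduct, star_star, Matrix.star_mulVec,
      (m.isHermitian y).eq, ← Matrix.dotProduct_mulVec]
  re_inner_nonneg v := by
    by_cases hv : v = 0
    · simp [hv]
    · exact (m.pos y v hv).le
  add_left := by simp [add_dotProduct]
  smul_left := by simp [smul_dotProduct]

theorem norm_add_le (m : BundleMetric (Y := Y) ρ) (y : Y) (v w : Fin d → K) :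
    m.norm y (v + w) ≤ m.norm y v + m.norm y w :=
  @SeminormedSpace.Core.norm_triangle K (Fin d → K) _ _ (_) _
    (InnerProductSpace.Core.toSeminormedSpaceCore (m.core y)) v w

theorem norm_smul (m : BundleMetric (Y := Y) ρ) (y : Y) (c : K) (v : Fin d → K) :
    m.norm y (c • v) = ‖c‖ * m.norm y v :=
  @SeminormedSpace.Core.norm_smul K (Fin d → K) _ _ (_) _
    (InnerProductSpace.Core.toSeminormedSpaceCore (m.core y)) c v

/-- The norm of a bundle metric, as a family of seminorms. -/
noncomputable def seminorm (m : BundleMetric (Y := Y) ρ) (y : Y) : Seminorm K (Fin d → K) :=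
  Seminorm.of (m.norm y) (m.norm_add_le y) (m.norm_smul y)

theorem continuous_norm (m : BundleMetric (Y := Y) ρ) :
    Continuous fun p : Y × (Fin d → K) => m.norm p.1 p.2 := by
  unfold BundleMetric.norm
  exact (RCLike.continuous_re.comp (Continuous.dotProduct (continuous_star.comp continuous_snd)
    ((m.continuous_gram.comp continuous_fst).matrix_mulVec continuous_snd))).sqrt

theorem norm_pos (m : BundleMetric (Y := Y) ρ) (y : Y) {v : Fin d → K} (hv : v ≠ 0) :
    0 < m.norm y v :=
  Real.sqrt_pos.2 (m.pos y v hv)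

theorem eq_zero_of_norm_eq_zero (m : BundleMetric (Y := Y) ρ) (y : Y) (v : Fin d → K)
    (h : m.norm y v = 0) : v = 0 := by
  by_contra hv
  exact (m.norm_pos y hv).ne' h

theorem norm_smul_mulVec (m : BundleMetric (Y := Y) ρ) (γ : Γ) (y : Y) (v : Fin d → K) :
    m.norm (γ • y) ((ρ γ).1.mulVec v) = m.norm y v := by
  unfold BundleMetric.norm
  rw [m.invariant]

/-- The metric obtained from a metric for `ρ₀` and an isomorphism from the bundle of `ρ` to the
bundle of `ρ₀`. -/
def pullback (m : BundleMetric (Y := Y) ρ₀) (q : Y → Matrix (Fin d) (Fin d) K)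
    (hq : Continuous q) (hinj : ∀ y v, (q y).mulVec v = 0 → v = 0)
    (heq : ∀ (γ : Γ) (y : Y), q (γ • y) * (ρ γ).1 = (ρ₀ γ).1 * q y) :
    BundleMetric (Y := Y) ρ where
  gram y := (q y).conjTranspose * m.gram y * q y
  continuous_gram := (hq.matrix_conjTranspose.matrix_mul m.continuous_gram).matrix_mul hq
  isHermitian y := Matrix.isHermitian_conjTranspose_mul_mul _ (m.isHermitian y)
  pos y v hv := by
    have := m.pos y ((q y).mulVec v) fun h => hv (hinj y v h)
    rwa [Matrix.star_mulVec, ← Matrix.dotProduct_mulVec, Matrix.mulVec_mulVec,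
      Matrix.mulVec_mulVec] at this
  invariant γ y v w := by
    have key (y : Y) (v w : Fin d → K) :
        star v ⬝ᵥ ((q y).conjTranspose * m.gram y * q y).mulVec w =
          star ((q y).mulVec v) ⬝ᵥ (m.gram y).mulVec ((q y).mulVec w) := by
      rw [Matrix.star_mulVec, ← Matrix.dotProduct_mulVec, Matrix.mulVec_mulVec,
        Matrix.mulVec_mulVec, Matrix.mul_assoc]
    have e (v : Fin d → K) : (q (γ • y)).mulVec ((ρ γ).1.mulVec v) =
        (ρ₀ γ).1.mulVec ((q y).mulVec v) := by
      rw [Matrix.mulVec_mulVec, heq, Matrix.mulVec_mulVec]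
    rw [key, key, e, e, m.invariant]

theorem pullback_norm (m : BundleMetric (Y := Y) ρ₀) (q : Y → Matrix (Fin d) (Fin d) K)
    (hq : Continuous q) (hinj : ∀ y v, (q y).mulVec v = 0 → v = 0)
    (heq : ∀ (γ : Γ) (y : Y), q (γ • y) * (ρ γ).1 = (ρ₀ γ).1 * q y) (y : Y) (v : Fin d → K) :
    (m.pullback q hq hinj heq).norm y v = m.norm y ((q y).mulVec v) := by
  unfold BundleMetric.norm
  congr 2
  change star v ⬝ᵥ ((q y).conjTranspose * m.gram y * q y).mulVec v = _
  rw [Matrix.star_mulVec, ← Matrix.dotProduct_mulVec, Matrix.mulVec_mulVec,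
    Matrix.mulVec_mulVec, Matrix.mul_assoc]

theorem exists_projection_bound (m : BundleMetric (Y := Y) ρ) {C : Set Y} (hC : IsCompact C)
    (hcov : ∀ y, ∃ γ : Γ, γ • y ∈ C) {P : Y → (Fin d → K) →ₗ[K] (Fin d → K)}
    (hP : ∀ v, Continuous fun y => P y v)
    (heq : ∀ (γ : Γ) y x, P (γ • y) ((ρ γ).1.mulVec x) = (ρ γ).1.mulVec (P y x)) :
    ∃ c > 0, ∀ y x, m.norm y (P y x) ≤ c * m.norm y x := by
  obtain ⟨c₁, hc₁, h₁⟩ := exists_mul_norm_le_of_isCompact (n := m.seminorm) m.continuous_norm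
    m.eq_zero_of_norm_eq_zero hC
  obtain ⟨c₂, hc₂, h₂⟩ := exists_le_mul_norm_of_isCompact
    (n := fun y => (m.seminorm y).comp (P y))
    (m.continuous_norm.comp (continuous_fst.prodMk (continuous_eval_of_pointwise hP))) hC
  refine ⟨c₂ / c₁, by positivity, fun y x => ?_⟩
  obtain ⟨γ, hγ⟩ := hcov y
  rw [← m.norm_smul_mulVec γ y, ← m.norm_smul_mulVec γ y x, ← heq]
  set z := γ • y
  set u := (ρ γ).1.mulVec x
  have i1 : c₁ * ‖u‖ ≤ m.norm z u := h₁ z hγ u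
  have i2 : m.norm z (P z u) ≤ c₂ * ‖u‖ := h₂ z hγ u
  rw [div_mul_eq_mul_div, le_div_iff₀ hc₁]
  nlinarith

/-- With `x = q y v`, the vector `u` is the change of `q v` along the flow. The relation is written
through `g` because the invertibility of `g` is itself one of the conclusions. Both follow by
translating the endpoint `φ τ y` or the point `y` into `C`. -/
theorem exists_close (m : BundleMetric (Y := Y) ρ₀) (φ : Flow ℝ Y)
    (hφ : ∀ (γ : Γ) (t : ℝ) (y : Y), φ t (γ • y) = γ • φ t y) {C : Set Y} (hC : IsCompact C)
    (hcov : ∀ y, ∃ γ : Γ, γ • y ∈ C) {T ε : ℝ} (hT : 0 ≤ T) (hε : 0 < ε) :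
    ∃ L : Set Y, IsCompact L ∧ ∃ η > 0, ∀ (ρ : Γ →* Matrix.SpecialLinearGroup (Fin d) K)
      (g : Y → Matrix (Fin d) (Fin d) K),
      (∀ (γ : Γ) y, g (γ • y) * (ρ₀ γ).1 = (ρ γ).1 * g y) →
      (∀ y ∈ L, ∀ x, ‖(g y).mulVec x - x‖ ≤ η * ‖x‖) →
      (∀ y x, (g y).mulVec x = 0 → x = 0) ∧
      ∀ y τ, 0 ≤ τ → τ ≤ T → ∀ x u, (g (φ τ y)).mulVec (x + u) = (g y).mulVec x →
        m.norm (φ τ y) u ≤ ε * m.norm (φ τ y) x := by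
  obtain ⟨c₁, hc₁, h₁⟩ := exists_mul_norm_le_of_isCompact (n := m.seminorm) m.continuous_norm
    m.eq_zero_of_norm_eq_zero hC
  obtain ⟨c₂, hc₂, h₂⟩ := exists_le_mul_norm_of_isCompact (n := m.seminorm) m.continuous_norm hC
  refine ⟨(fun p : ℝ × Y => φ (-p.1) p.2) '' (Set.Icc 0 T ×ˢ C),
    (isCompact_Icc.prod hC).image (φ.continuous continuous_fst.neg continuous_snd),
    -- The bound `1 / 2` gives `‖x‖ ≤ 2 * ‖g x‖` over `C`. Then `‖u‖ ≤ 4 * η * ‖x‖`, and the second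
    -- bound converts this to the bundle metric.
    min (1 / 2) (ε * c₁ / (4 * c₂)), by positivity, fun ρ g hg hL => ?_⟩
  set η := min (1 / 2) (ε * c₁ / (4 * c₂))
  have hη1 : η ≤ 1 / 2 := min_le_left _ _
  have hη2 : η * (4 * c₂) ≤ ε * c₁ := by
    rw [← le_div_iff₀ (by positivity)]; exact min_le_right _ _
  have hη0 : 0 < η := by positivity
  have hLC (z : Y) (hz : z ∈ C) (τ : ℝ) (h0 : 0 ≤ τ) (h1 : τ ≤ T) (x : Fin d → K) :
      ‖(g (φ (-τ) z)).mulVec x - x‖ ≤ η * ‖x‖ :=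
    hL _ ⟨(τ, z), ⟨⟨h0, h1⟩, hz⟩, rfl⟩ x
  have hLC0 (z : Y) (hz : z ∈ C) (x : Fin d → K) : ‖(g z).mulVec x - x‖ ≤ η * ‖x‖ := by
    simpa using hLC z hz 0 le_rfl hT x
  have hlow (z : Y) (hz : z ∈ C) (x : Fin d → K) : ‖x‖ ≤ 2 * ‖(g z).mulVec x‖ := by
    have i1 := hLC0 z hz x
    have i2 : ‖x‖ ≤ ‖(g z).mulVec x‖ + ‖(g z).mulVec x - x‖ := by
      simpa using norm_sub_le ((g z).mulVec x) ((g z).mulVec x - x)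
    nlinarith [norm_nonneg x]
  have hginv (γ : Γ) (y : Y) (x : Fin d → K) :
      (g (γ • y)).mulVec ((ρ₀ γ).1.mulVec x) = (ρ γ).1.mulVec ((g y).mulVec x) := by
    rw [Matrix.mulVec_mulVec, Matrix.mulVec_mulVec, hg]
  refine ⟨fun y x hx => ?_, fun y τ h0 h1 x u hu => ?_⟩
  · obtain ⟨γ, hγ⟩ := hcov y
    have i1 := hlow _ hγ ((ρ₀ γ).1.mulVec x)
    rw [hginv, hx, Matrix.mulVec_zero, norm_zero, mul_zero] at i1
    have i2 : (ρ₀ γ).1.mulVec x = 0 := norm_le_zero_iff.1 i1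
    refine m.eq_zero_of_norm_eq_zero y x ?_
    rw [← m.norm_smul_mulVec γ, i2]
    exact map_zero (m.seminorm (γ • y))
  · obtain ⟨γ, hγ⟩ := hcov (φ τ y)
    rw [← m.norm_smul_mulVec γ _ u, ← m.norm_smul_mulVec γ _ x]
    have hu' := congrArg (ρ γ).1.mulVec hu
    rw [← hginv, ← hginv, Matrix.mulVec_add] at hu'
    have e : γ • y = φ (-τ) (γ • φ τ y) := by
      rw [← hφ, ← Flow.map_add]; simp
    rw [e] at hu'
    set z := γ • φ τ y
    set x' := (ρ₀ γ).1.mulVec x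
    set u' := (ρ₀ γ).1.mulVec u
    have e2 : (g z).mulVec u' = ((g (φ (-τ) z)).mulVec x' - x') - ((g z).mulVec x' - x') := by
      rw [← hu', Matrix.mulVec_add]; abel
    have i1 := hlow z hγ u'
    have i2 := norm_sub_le ((g (φ (-τ) z)).mulVec x' - x') ((g z).mulVec x' - x')
    rw [← e2] at i2
    have i3 := hLC z hγ τ h0 h1 x'
    have i4 := hLC0 z hγ x'
    have i5 : c₁ * ‖x'‖ ≤ m.norm z x' := h₁ z hγ x'
    have i6 : m.norm z u' ≤ c₂ * ‖u'‖ := h₂ z hγ u'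
    calc m.norm z u' ≤ c₂ * ‖u'‖ := i6
      _ ≤ c₂ * (4 * (η * ‖x'‖)) := by gcongr; linarith
      _ = η * (4 * c₂) * ‖x'‖ := by ring
      _ ≤ ε * c₁ * ‖x'‖ := by gcongr
      _ = ε * (c₁ * ‖x'‖) := by ring
      _ ≤ _ := by gcongr

end BundleMetric

/-! ### Persistence of domination under perturbation -/

theorem IsDominatedSplitting.exists_mul_le {Γ Y K : Type*} [Group Γ] [TopologicalSpace Y]
    [MulAction Γ Y] [RCLike K] {d k : ℕ} {φ : GammaFlow Γ Y}
    {ρ : Γ →* Matrix.SpecialLinearGroup (Fin d) K} {m : BundleMetric (Y := Y) ρ}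
    {Es Eu : Y → Submodule K (Fin d → K)} (h : IsDominatedSplitting φ k ρ m Es Eu) :
    ∃ C > 0, ∃ α > 0, ∀ y t, 0 ≤ t → ∀ v ∈ Es y, ∀ w ∈ Eu y,
      m.norm (φ.toFlow t y) v * m.norm y w ≤
        C * Real.exp (-α * t) * (m.norm y v * m.norm (φ.toFlow t y) w) := by
  obtain ⟨C, hC, α, hα, h⟩ := h.dominated
  refine ⟨C, hC, α, hα, fun y t ht v hv w hw => ?_⟩
  have z (y : Y) : m.norm y 0 = 0 := map_zero (m.seminorm y)
  by_cases hv0 : v = 0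
  · simp [hv0, z]
  by_cases hw0 : w = 0
  · simp [hw0, z]
  have := h y t ht v hv hv0 w hw hw0
  have p1 := m.norm_pos y hw0
  have p2 := m.norm_pos (φ.toFlow t y) hw0
  rw [← mul_div_assoc, div_le_div_iff₀ p2 p1] at this
  linarith

/-- Primed letters are the perturbed components at the final time, Greek letters those carried along
by the unperturbed flow. The cone conditions let one component control each sum, with factors 5 and
2. The perturbation leaves at least `3 / 4` of the total for `w`, and `10 ≤ 14 * (3 / 4)`. -/
theorem contraction_of_close {θ av bv av' bv' αv βv aw bw aw' bw' αw βw : ℝ} (hθ : 0 ≤ θ)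
    (hav : 0 ≤ av) (hbv : 0 ≤ bv) (hαv : 0 ≤ αv) (hbw : 0 ≤ bw) (hαw : 0 ≤ αw) (hβw : 0 ≤ βw)
    (h1 : |av' - αv| ≤ (αv + βv) / 8) (h2 : |bv' - βv| ≤ (αv + βv) / 8)
    (h3 : |aw' - αw| ≤ (αw + βw) / 8) (h4 : |bw' - βw| ≤ (αw + βw) / 8)
    (hv : bv' ≤ av') (hw : aw ≤ bw) (hdom : αv * bw ≤ θ * (av * βw)) :
    (av' + bv') * (aw + bw) ≤ 14 * θ * ((av + bv) * (aw' + bw')) := by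
  rw [abs_le] at h1 h2 h3 h4
  have i1 : av' + bv' ≤ 5 * αv := by linarith
  have i2 : aw + bw ≤ 2 * bw := by linarith
  have i3 : 10 * βw ≤ 14 * (aw' + bw') := by linarith
  calc (av' + bv') * (aw + bw) ≤ (av' + bv') * (2 * bw) := by
        apply mul_le_mul_of_nonneg_left i2; linarith
    _ ≤ (5 * αv) * (2 * bw) := by gcongr
    _ = 10 * (αv * bw) := by ring
    _ ≤ 10 * (θ * (av * βw)) := by gcongr
    _ = θ * (av * (10 * βw)) := by ring
    _ ≤ θ * ((av + bv) * (14 * (aw' + bw'))) := by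
        gcongr
        linarith
    _ = _ := by ring

theorem ConeDomination.bundle_eq_map {Y K V : Type*} [TopologicalSpace Y] [RCLike K]
    [NormedAddCommGroup V] [NormedSpace K V] {φ : Flow ℝ Y} {a b : Y → Seminorm K V} {T : ℝ}
    (h : ConeDomination φ a b T) {y z : Y} (f : V →ₗ[K] V) (hf : Function.Surjective f)
    (ha : ∀ t v, a (φ t z) (f v) = a (φ t y) v) (hb : ∀ t v, b (φ t z) (f v) = b (φ t y) v) :
    h.bundle z = (h.bundle y).map f := by
  ext v
  obtain ⟨w, rfl⟩ := hf v
  constructor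
  · intro hv
    refine ⟨w, fun t => ?_, rfl⟩
    rw [← ha, ← hb]
    exact hv t
  · rintro ⟨w', hw', e⟩
    rw [← e]
    intro t
    rw [ha, hb]
    exact hw' t

section

variable {Γ Y K : Type*} [Group Γ] [TopologicalSpace Y] [MulAction Γ Y] [RCLike K] {d k : ℕ}
  {ρ₀ ρ : Γ →* Matrix.SpecialLinearGroup (Fin d) K}

/-- The norm of the component of `q y v` selected by `P y`. -/
noncomputable def BundleMetric.component (m : BundleMetric (Y := Y) ρ₀)
    (P : Y → (Fin d → K) →ₗ[K] (Fin d → K)) (q : Y → Matrix (Fin d) (Fin d) K) (y : Y) :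
    Seminorm K (Fin d → K) :=
  (m.seminorm y).comp (P y ∘ₗ Matrix.toLin' (q y))

theorem BundleMetric.component_apply (m : BundleMetric (Y := Y) ρ₀)
    (P : Y → (Fin d → K) →ₗ[K] (Fin d → K)) (q : Y → Matrix (Fin d) (Fin d) K) (y : Y)
    (v : Fin d → K) : m.component P q y v = m.norm y (P y ((q y).mulVec v)) := rfl

theorem BundleMetric.continuous_component (m : BundleMetric (Y := Y) ρ₀)
    {P : Y → (Fin d → K) →ₗ[K] (Fin d → K)} (hP : ∀ v, Continuous fun y => P y v)
    {q : Y → Matrix (Fin d) (Fin d) K} (hq : Continuous q) :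
    Continuous fun p : Y × (Fin d → K) => m.component P q p.1 p.2 :=
  m.continuous_norm.comp (continuous_fst.prodMk ((continuous_eval_of_pointwise hP).comp
    (continuous_fst.prodMk ((hq.comp continuous_fst).matrix_mulVec continuous_snd))))

namespace IsDominatedSplitting

variable {φ : GammaFlow Γ Y} {m : BundleMetric (Y := Y) ρ₀}
  {Es Eu : Y → Submodule K (Fin d → K)}

/-- The projection to the stable bundle along the unstable bundle. -/
noncomputable def projStable (h : IsDominatedSplitting φ k ρ₀ m Es Eu) (y : Y) :
    (Fin d → K) →ₗ[K] (Fin d → K) :=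
  (Es y).projection (Eu y) (h.isCompl y)

/-- The projection to the unstable bundle along the stable bundle. -/
noncomputable def projUnstable (h : IsDominatedSplitting φ k ρ₀ m Es Eu) (y : Y) :
    (Fin d → K) →ₗ[K] (Fin d → K) :=
  (Eu y).projection (Es y) (h.isCompl y).symm

theorem projStable_add_projUnstable (h : IsDominatedSplitting φ k ρ₀ m Es Eu) (y : Y)
    (v : Fin d → K) : h.projStable y v + h.projUnstable y v = v :=
  Submodule.projection_add_projection_eq_self _ v

theorem norm_le_add (h : IsDominatedSplitting φ k ρ₀ m Es Eu) (y z : Y)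
    (v : Fin d → K) : m.norm z v ≤ m.norm z (h.projStable y v) + m.norm z (h.projUnstable y v) := by
  conv_lhs => rw [← h.projStable_add_projUnstable y v]
  exact m.norm_add_le z _ _

theorem continuous_projStable (h : IsDominatedSplitting φ k ρ₀ m Es Eu) (v : Fin d → K) :
    Continuous fun y => h.projStable y v :=
  h.stable_subbundle.continuous_projection h.unstable_subbundle h.isCompl v

theorem continuous_projUnstable (h : IsDominatedSplitting φ k ρ₀ m Es Eu) (v : Fin d → K) :
    Continuous fun y => h.projUnstable y v :=
  h.unstable_subbundle.continuous_projection h.stable_subbundle (fun y => (h.isCompl y).symm) v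

theorem projStable_smul (h : IsDominatedSplitting φ k ρ₀ m Es Eu) (γ : Γ) (y : Y)
    (v : Fin d → K) :
    h.projStable (γ • y) ((ρ₀ γ).1.mulVec v) = (ρ₀ γ).1.mulVec (h.projStable y v) :=
  projection_map (h.isCompl y) (h.isCompl (γ • y)) (Matrix.toLin' (ρ₀ γ).1) (h.stable_group γ y)
    (h.unstable_group γ y) v

theorem projUnstable_smul (h : IsDominatedSplitting φ k ρ₀ m Es Eu) (γ : Γ) (y : Y)
    (v : Fin d → K) :
    h.projUnstable (γ • y) ((ρ₀ γ).1.mulVec v) = (ρ₀ γ).1.mulVec (h.projUnstable y v) :=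
  projection_map (h.isCompl y).symm (h.isCompl (γ • y)).symm (Matrix.toLin' (ρ₀ γ).1)
    (h.unstable_group γ y) (h.stable_group γ y) v

theorem projStable_flow (h : IsDominatedSplitting φ k ρ₀ m Es Eu) (t : ℝ) (y : Y)
    (v : Fin d → K) : h.projStable (φ.toFlow t y) v = h.projStable y v :=
  projection_map (h.isCompl y) (h.isCompl _) LinearMap.id
    (by rw [Submodule.map_id, h.stable_flow]) (by rw [Submodule.map_id, h.unstable_flow]) v

theorem projUnstable_flow (h : IsDominatedSplitting φ k ρ₀ m Es Eu) (t : ℝ) (y : Y)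
    (v : Fin d → K) : h.projUnstable (φ.toFlow t y) v = h.projUnstable y v :=
  projection_map (h.isCompl y).symm (h.isCompl _).symm LinearMap.id
    (by rw [Submodule.map_id, h.unstable_flow]) (by rw [Submodule.map_id, h.stable_flow]) v

theorem component_projStable_eq_zero_iff (h : IsDominatedSplitting φ k ρ₀ m Es Eu)
    (q : Y → Matrix (Fin d) (Fin d) K) (y : Y) (v : Fin d → K) :
    m.component h.projStable q y v = 0 ↔ v ∈ (Eu y).comap (Matrix.toLin' (q y)) := by
  rw [BundleMetric.component_apply, Submodule.mem_comap, Matrix.toLin'_apply,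
    ← Submodule.projection_apply_eq_zero_iff (h.isCompl y)]
  exact ⟨m.eq_zero_of_norm_eq_zero _ _, fun e => (congrArg _ e).trans (map_zero (m.seminorm y))⟩

theorem component_projUnstable_eq_zero_iff (h : IsDominatedSplitting φ k ρ₀ m Es Eu)
    (q : Y → Matrix (Fin d) (Fin d) K) (y : Y) (v : Fin d → K) :
    m.component h.projUnstable q y v = 0 ↔ v ∈ (Es y).comap (Matrix.toLin' (q y)) := by
  rw [BundleMetric.component_apply, Submodule.mem_comap, Matrix.toLin'_apply,
    ← Submodule.projection_apply_eq_zero_iff (h.isCompl y).symm]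
  exact ⟨m.eq_zero_of_norm_eq_zero _ _, fun e => (congrArg _ e).trans (map_zero (m.seminorm y))⟩

theorem component_smul {P : Y → (Fin d → K) →ₗ[K] (Fin d → K)}
    (hP : ∀ (γ : Γ) y v, P (γ • y) ((ρ₀ γ).1.mulVec v) = (ρ₀ γ).1.mulVec (P y v))
    {q : Y → Matrix (Fin d) (Fin d) K}
    (heq : ∀ (γ : Γ) (y : Y), q (γ • y) * (ρ γ).1 = (ρ₀ γ).1 * q y) (γ : Γ) (y : Y)
    (v : Fin d → K) :
    m.component P q (γ • y) ((ρ γ).1.mulVec v) = m.component P q y v := by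
  rw [BundleMetric.component_apply, BundleMetric.component_apply, Matrix.mulVec_mulVec, heq,
    ← Matrix.mulVec_mulVec, hP, m.norm_smul_mulVec]

/-- The two cone bundles form the new splitting. The metric pulled back by `q` is uniformly
equivalent to `a + b`, so the domination for `a + b` passes to it. -/
theorem isAnosovInRestriction_of_coneDomination (h : IsDominatedSplitting φ k ρ₀ m Es Eu)
    {q : Y → Matrix (Fin d) (Fin d) K} (hq : Continuous q)
    (hinj : ∀ y v, (q y).mulVec v = 0 → v = 0)
    (heq : ∀ (γ : Γ) (y : Y), q (γ • y) * (ρ γ).1 = (ρ₀ γ).1 * q y) {T D c : ℝ} (hc : 0 < c)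
    (hs : ∀ y v, m.norm y (h.projStable y v) ≤ c * m.norm y v)
    (hu : ∀ y v, m.norm y (h.projUnstable y v) ≤ c * m.norm y v)
    (hcd : ConeDomination φ.toFlow (m.component h.projStable q) (m.component h.projUnstable q) T)
    (hD : ∀ y τ, 0 ≤ τ → τ ≤ T → ∀ v w,
      m.component h.projUnstable q (φ.toFlow τ y) v ≤
        m.component h.projStable q (φ.toFlow τ y) v →
      m.component h.projStable q y w ≤ m.component h.projUnstable q y w →
      (m.component h.projStable q (φ.toFlow τ y) + m.component h.projUnstable q (φ.toFlow τ y)) v *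
        (m.component h.projStable q y + m.component h.projUnstable q y) w ≤
        D * ((m.component h.projStable q y + m.component h.projUnstable q y) v *
          (m.component h.projStable q (φ.toFlow τ y) +
            m.component h.projUnstable q (φ.toFlow τ y)) w)) :
    IsAnosovInRestriction φ k ρ := by
  set a := m.component h.projStable q
  set b := m.component h.projUnstable q
  -- The old splitting transported by `q` need not be flow invariant. It serves as a reference of
  -- the right ranks, complementary to the new bundles.
  let Fs : Y → Submodule K (Fin d → K) := fun y => (Es y).comap (Matrix.toLin' (q y))
  let Fu : Y → Submodule K (Fin d → K) := fun y => (Eu y).comap (Matrix.toLin' (q y))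
  have hFs (y v) : v ∈ Fs y ↔ b y v = 0 := (h.component_projUnstable_eq_zero_iff q y v).symm
  have hFu (y v) : v ∈ Fu y ↔ a y v = 0 := (h.component_projStable_eq_zero_iff q y v).symm
  have hcomap (y : Y) (E : Submodule K (Fin d → K)) :
      Module.finrank K (E.comap (Matrix.toLin' (q y))) = Module.finrank K E := by
    have hi : Function.Injective (Matrix.toLin' (q y)) :=
      (injective_iff_map_eq_zero _).2 (hinj y)
    let e := LinearEquiv.ofInjectiveEndo _ hi
    change Module.finrank K (E.comap (e : (Fin d → K) →ₗ[K] (Fin d → K))) = _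
    rw [Submodule.comap_equiv_eq_map_symm]
    exact LinearEquiv.finrank_map_eq e.symm E
  have hrs (y) : Module.finrank K (Fs y) = k := (hcomap y _).trans (h.stable_subbundle.finrank_eq y)
  have hru (y) : Module.finrank K (Fu y) = d - k :=
    (hcomap y _).trans (h.unstable_subbundle.finrank_eq y)
  have hsum (y : Y) : k + (d - k) = Module.finrank K (Fin d → K) := by
    have := Submodule.finrank_add_eq_of_isCompl (h.isCompl y)
    rwa [h.stable_subbundle.finrank_eq y, h.unstable_subbundle.finrank_eq y] at this
  have hr1 (y z) : Module.finrank K (Fu z) + Module.finrank K (Fs y) =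
      Module.finrank K (Fin d → K) := by rw [hrs, hru, ← hsum y, add_comm]
  have hr2 (y z) : Module.finrank K (Fs z) + Module.finrank K (Fu y) =
      Module.finrank K (Fin d → K) := by rw [hrs, hru, ← hsum y]
  have hcu := hcd.isCompl_bundle_ker hFs hFu hr1
  have hcs := hcd.reverse.isCompl_bundle_ker hFu hFs hr2
  have hku (y) : Module.finrank K (hcd.bundle y) = d - k :=
    (hcd.finrank_bundle hFs hFu hr1 y).trans (hru y)
  have hks (y) : Module.finrank K (hcd.reverse.bundle y) = k :=
    (hcd.reverse.finrank_bundle hFu hFs hr2 y).trans (hrs y)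
  have hca := component_smul (m := m) (ρ := ρ) h.projStable_smul heq
  have hcb := component_smul (m := m) (ρ := ρ) h.projUnstable_smul heq
  have hsurj (γ : Γ) : Function.Surjective (Matrix.toLin' (ρ γ).1) := by
    intro v
    refine ⟨(ρ γ⁻¹).1.mulVec v, ?_⟩
    rw [Matrix.toLin'_apply, Matrix.mulVec_mulVec, ← Matrix.SpecialLinearGroup.coe_mul, ← map_mul]
    simp
  have hn1 (y v) : (m.pullback q hq hinj heq).norm y v ≤ (a y + b y) v := by
    rw [BundleMetric.pullback_norm]
    exact h.norm_le_add y y _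
  have hn2 (y v) : (a y + b y) v ≤ 2 * c * (m.pullback q hq hinj heq).norm y v := by
    rw [BundleMetric.pullback_norm]
    have i1 := hs y ((q y).mulVec v)
    have i2 := hu y ((q y).mulVec v)
    change m.norm y (h.projStable y ((q y).mulVec v)) +
      m.norm y (h.projUnstable y ((q y).mulVec v)) ≤ _
    linarith
  refine ⟨m.pullback q hq hinj heq, hcd.reverse.bundle, hcd.bundle, ?_⟩
  refine
    { stable_subbundle := isSubbundle_of_continuous
        (fun y => (hcd.reverse.bundle y).projection (Fu y) (hcs y))
        (hcd.reverse.continuous_projection hFu hcs)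
        (fun y v => Submodule.projection_apply_mem _ _)
        (fun y v hv => Submodule.projection_apply_of_mem_left _ hv) hks
      unstable_subbundle := isSubbundle_of_continuous
        (fun y => (hcd.bundle y).projection (Fs y) (hcu y))
        (hcd.continuous_projection hFs hcu)
        (fun y v => Submodule.projection_apply_mem _ _)
        (fun y v hv => Submodule.projection_apply_of_mem_left _ hv) hku
      isCompl := fun y => ⟨(hcd.disjoint_bundle y).symm, ?_⟩
      stable_group := fun γ y => hcd.reverse.bundle_eq_map _ (hsurj γ) ?_ ?_
      unstable_group := fun γ y => hcd.bundle_eq_map _ (hsurj γ) ?_ ?_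
      stable_flow := fun t y => ?_
      unstable_flow := hcd.bundle_flow
      dominated := ?_ }
  · rw [codisjoint_iff]
    -- The bundles meet trivially and their ranks `k` and `d - k` add up to the dimension.
    refine Submodule.eq_top_of_disjoint _ _ ?_ (hcd.disjoint_bundle y).symm
    rw [hks, hku, hsum y]
  · intro t v
    rw [Flow.reverse_apply, Flow.reverse_apply, φ.commutes, Matrix.toLin'_apply]
    exact hcb γ _ v
  · intro t v
    rw [Flow.reverse_apply, Flow.reverse_apply, φ.commutes, Matrix.toLin'_apply]
    exact hca γ _ v
  · intro t v
    rw [φ.commutes, Matrix.toLin'_apply]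
    exact hca γ _ v
  · intro t v
    rw [φ.commutes, Matrix.toLin'_apply]
    exact hcb γ _ v
  · have := hcd.reverse.bundle_flow (-t) y
    rwa [Flow.reverse_apply, neg_neg] at this
  · obtain ⟨C, hC, α, hα, hdom⟩ := hcd.dominated_bundle hD
    -- One factor `2 * c` comes from each of the two comparisons `a + b ≤ 2 * c * N` on the
    -- right-hand side.
    refine ⟨C * (2 * c) ^ 2, by positivity, α, hα, fun y t ht v hv hv0 w hw hw0 => ?_⟩
    have i1 := hdom y t ht v hv w hw
    set z := φ.toFlow t y
    set N := m.pullback q hq hinj heq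
    have p1 := N.norm_pos y hv0
    have p2 := N.norm_pos y hw0
    have p3 := N.norm_pos z hv0
    have p4 := N.norm_pos z hw0
    rw [← mul_div_assoc, div_le_div_iff₀ p4 p2]
    calc N.norm z v * N.norm y w ≤ (a z + b z) v * (a y + b y) w :=
          mul_le_mul (hn1 z v) (hn1 y w) p2.le (p3.le.trans (hn1 z v))
      _ ≤ C * Real.exp (-α * t) * ((a y + b y) v * (a z + b z) w) := i1
      _ ≤ C * Real.exp (-α * t) * ((2 * c * N.norm y v) * (2 * c * N.norm z w)) := by
          refine mul_le_mul_of_nonneg_left ?_ (by positivity)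
          exact mul_le_mul (hn2 y v) (hn2 z w) (p4.le.trans (hn1 z w)) (by positivity)
      _ = _ := by ring

/-- Since the projections for `ρ₀` are constant along the flow, the components at `φ τ y` differ
from the transported ones only through the variation of `q`. The tolerance `1 / (8 * c)` cancels the
projection bound `c` and leaves the relative error `1 / 8`. -/
theorem component_contraction (h : IsDominatedSplitting φ k ρ₀ m Es Eu)
    {q : Y → Matrix (Fin d) (Fin d) K} {c C α : ℝ} (hc : 0 < c) (hC : 0 < C)
    (hs : ∀ y v, m.norm y (h.projStable y v) ≤ c * m.norm y v)
    (hu : ∀ y v, m.norm y (h.projUnstable y v) ≤ c * m.norm y v)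
    (hdom : ∀ y t, 0 ≤ t → ∀ v ∈ Es y, ∀ w ∈ Eu y,
      m.norm (φ.toFlow t y) v * m.norm y w ≤
        C * Real.exp (-α * t) * (m.norm y v * m.norm (φ.toFlow t y) w))
    {y : Y} {τ : ℝ} (h0 : 0 ≤ τ)
    (hclose : ∀ v, m.norm (φ.toFlow τ y) ((q (φ.toFlow τ y)).mulVec v - (q y).mulVec v) ≤
      1 / (8 * c) * m.norm (φ.toFlow τ y) ((q y).mulVec v)) {v w : Fin d → K}
    (hv : m.component h.projUnstable q (φ.toFlow τ y) v ≤
        m.component h.projStable q (φ.toFlow τ y) v)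
    (hw : m.component h.projStable q y w ≤ m.component h.projUnstable q y w) :
    (m.component h.projStable q (φ.toFlow τ y) + m.component h.projUnstable q (φ.toFlow τ y)) v *
        (m.component h.projStable q y + m.component h.projUnstable q y) w ≤
      14 * (C * Real.exp (-α * τ)) *
        ((m.component h.projStable q y + m.component h.projUnstable q y) v *
          (m.component h.projStable q (φ.toFlow τ y) +
            m.component h.projUnstable q (φ.toFlow τ y)) w) := by
  set z := φ.toFlow τ y
  have close {P : Y → (Fin d → K) →ₗ[K] (Fin d → K)} (hP : P z = P y)
      (hb : ∀ y v, m.norm y (P y v) ≤ c * m.norm y v) (v : Fin d → K) :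
      |m.component P q z v - m.norm z (P y ((q y).mulVec v))| ≤
        (m.norm z (h.projStable y ((q y).mulVec v)) +
          m.norm z (h.projUnstable y ((q y).mulVec v))) / 8 := by
    rw [BundleMetric.component_apply, hP]
    have i1 := abs_sub_map_le_sub (m.seminorm z) (P y ((q z).mulVec v)) (P y ((q y).mulVec v))
    rw [← map_sub (P y)] at i1
    have i2 := hb z ((q z).mulVec v - (q y).mulVec v)
    have i3 := h.norm_le_add y z ((q y).mulVec v)
    have i4 := hclose v
    rw [hP] at i2
    calc |m.norm z (P y ((q z).mulVec v)) - m.norm z (P y ((q y).mulVec v))|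
      _ ≤ c * m.norm z ((q z).mulVec v - (q y).mulVec v) := i1.trans i2
      _ ≤ c * (1 / (8 * c) * m.norm z ((q y).mulVec v)) := by gcongr
      _ = m.norm z ((q y).mulVec v) / 8 := by field_simp
      _ ≤ _ := by gcongr
  have hPs : h.projStable z = h.projStable y := LinearMap.ext (h.projStable_flow τ y)
  have hPu : h.projUnstable z = h.projUnstable y := LinearMap.ext (h.projUnstable_flow τ y)
  exact contraction_of_close (by positivity) (apply_nonneg _ _) (apply_nonneg _ _)
    (apply_nonneg (m.seminorm z) _) (apply_nonneg _ _) (apply_nonneg (m.seminorm z) _)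
    (apply_nonneg (m.seminorm z) _) (close hPs hs v) (close hPu hu v) (close hPs hs w)
    (close hPu hu w) hv hw
    (hdom y τ h0 _ (Submodule.projection_apply_mem _ _) _ (Submodule.projection_apply_mem _ _))

end IsDominatedSplitting

/-! ### Openness -/

theorem IsAnosovInRestriction.eventually {φ : GammaFlow Γ Y} (hφ : φ.IsCocompact)
    (h : IsAnosovInRestriction φ k ρ₀) :
    ∀ᶠ ρ in @nhds _ (homTopology Γ d K) ρ₀, IsAnosovInRestriction φ k ρ := by
  obtain ⟨m, Es, Eu, h⟩ := h
  have hpd := φ.properlyDiscontinuous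
  have : T2Space Y := φ.t2
  have : ContinuousConstSMul Γ Y := ⟨φ.continuous_action⟩
  have : CompactSpace (Quotient (MulAction.orbitRel Γ Y)) := hφ
  have := hpd.weaklyLocallyCompactSpace
  obtain ⟨A, hA, hcov⟩ := exists_isCompact_forall_smul_mem (Γ := Γ) (Y := Y)
  obtain ⟨χ, hχ, hχ0, hχc, hχ1⟩ := hpd.exists_cutoff
  obtain ⟨c₁, hc₁, hs⟩ := m.exists_projection_bound hA hcov h.continuous_projStable
    h.projStable_smul
  obtain ⟨c₂, hc₂, hu⟩ := m.exists_projection_bound hA hcov h.continuous_projUnstable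
    h.projUnstable_smul
  obtain ⟨C, hC, α, hα, hdom⟩ := h.exists_mul_le
  obtain ⟨T, hT, hTC⟩ : ∃ T > 0, 14 * (C * Real.exp (-α * T)) ≤ 1 / 2 := by
    -- Here `exp (-α * T) = 1 / (28 * C + 1)`, so `14 * C` times it is at most `1 / 2`. The added 1
    -- makes the logarithm, hence `T`, positive.
    refine ⟨Real.log (28 * C + 1) / α, div_pos (Real.log_pos (by linarith)) hα, ?_⟩
    have e : -α * (Real.log (28 * C + 1) / α) = -Real.log (28 * C + 1) := by field_simp
    rw [e, Real.exp_neg, Real.exp_log (by positivity), ← mul_assoc, ← div_eq_mul_inv,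
      div_le_iff₀ (by positivity)]
    linarith
  set c := max c₁ c₂
  have hc : 0 < c := lt_max_of_lt_left hc₁
  have nn (y v) : 0 ≤ m.norm y v := Real.sqrt_nonneg _
  replace hs (y v) : m.norm y (h.projStable y v) ≤ c * m.norm y v :=
    (hs y v).trans (mul_le_mul_of_nonneg_right (le_max_left _ _) (nn _ _))
  replace hu (y v) : m.norm y (h.projUnstable y v) ≤ c * m.norm y v :=
    (hu y v).trans (mul_le_mul_of_nonneg_right (le_max_right _ _) (nn _ _))
  -- Closeness is needed only up to time `2 * T`: the window `[T, 2T]` generates all longer times by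
  -- iteration.
  obtain ⟨L, hL, η, hη, hclose⟩ := m.exists_close φ.toFlow φ.commutes hA hcov
    (by positivity : 0 ≤ 2 * T) (by positivity : 0 < 1 / (8 * c))
  filter_upwards [eventually_norm_intertwiner_sub_le hpd hχ0 hχc hχ1 ρ₀ hL hη] with ρ hρ
  set g := intertwiner χ ρ₀ ρ
  have hg : Continuous g := continuous_intertwiner hpd hχ hχc ρ₀ ρ
  have hgeq (γ : Γ) (y : Y) : g (γ • y) * (ρ₀ γ).1 = (ρ γ).1 * g y :=
    intertwiner_smul_mul hpd hχc ρ₀ ρ γ y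
  obtain ⟨hginj, hgclose⟩ := hclose ρ g hgeq hρ
  have hdet (y : Y) : IsUnit (g y).det := by
    rw [← Matrix.isUnit_iff_isUnit_det, ← Matrix.mulVec_injective_iff_isUnit]
    exact (injective_iff_map_eq_zero (Matrix.toLin' (g y))).2 (hginj y)
  let q : Y → Matrix (Fin d) (Fin d) K := fun y => (g y)⁻¹
  have hgq (y v) : (g y).mulVec ((q y).mulVec v) = v := by
    rw [Matrix.mulVec_mulVec, Matrix.mul_nonsing_inv _ (hdet y), Matrix.one_mulVec]
  have hq : Continuous q := by
    simp only [q, Matrix.inv_def, Ring.inverse_eq_inv']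
    exact (hg.matrix_det.inv₀ fun y => (hdet y).ne_zero).smul hg.matrix_adjugate
  have hinj (y v) (hv : (q y).mulVec v = 0) : v = 0 := by
    rw [← hgq y v, hv, Matrix.mulVec_zero]
  have hqeq (γ : Γ) (y : Y) : q (γ • y) * (ρ γ).1 = (ρ₀ γ).1 * q y := by
    calc q (γ • y) * (ρ γ).1 = q (γ • y) * ((ρ γ).1 * (g y * q y)) := by
          rw [Matrix.mul_nonsing_inv _ (hdet y), Matrix.mul_one]
      _ = q (γ • y) * (g (γ • y) * (ρ₀ γ).1) * q y := by
          rw [hgeq]; simp only [Matrix.mul_assoc]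
      _ = _ := by
          rw [← Matrix.mul_assoc, Matrix.nonsing_inv_mul _ (hdet _), Matrix.one_mul]
  have hqclose (y τ) (h0 : 0 ≤ τ) (h1 : τ ≤ 2 * T) (v) :
      m.norm (φ.toFlow τ y) ((q (φ.toFlow τ y)).mulVec v - (q y).mulVec v) ≤
        1 / (8 * c) * m.norm (φ.toFlow τ y) ((q y).mulVec v) := by
    refine hgclose y τ h0 h1 _ _ ?_
    rw [add_sub_cancel, hgq, hgq]
  -- On `[0, T]` the exponential is at most 1, so the same estimate gives the constant `14 * C`.
  refine h.isAnosovInRestriction_of_coneDomination hq hinj hqeq hc hs hu (T := T)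
    (D := 14 * C) ?_ ?_
  · refine ⟨hT, m.continuous_component h.continuous_projStable hq,
      m.continuous_component h.continuous_projUnstable hq, fun y v h1 h2 => ?_,
      fun y τ h1 h2 v w hv hw => ?_⟩
    · refine hinj y v (m.eq_zero_of_norm_eq_zero y _ (le_antisymm ?_ (nn _ _)))
      rw [BundleMetric.component_apply] at h1 h2
      have := h.norm_le_add y y ((q y).mulVec v)
      rwa [h1, h2, add_zero] at this
    · refine (h.component_contraction hc hC hs hu hdom (hT.le.trans h1)
        (hqclose y τ (hT.le.trans h1) h2) hv hw).trans
        (mul_le_mul_of_nonneg_right (le_trans ?_ hTC) ?_)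
      · have : Real.exp (-α * τ) ≤ Real.exp (-α * T) := Real.exp_le_exp.2 (by nlinarith)
        gcongr
      · exact mul_nonneg (apply_nonneg _ _) (apply_nonneg _ _)
  · intro y τ h1 h2 v w hv hw
    refine (h.component_contraction hc hC hs hu hdom h1
      (hqclose y τ h1 (by linarith)) hv hw).trans (mul_le_mul_of_nonneg_right ?_ ?_)
    · have : Real.exp (-α * τ) ≤ 1 := Real.exp_le_one_iff.2 (by nlinarith)
      nlinarith
    · exact mul_nonneg (apply_nonneg _ _) (apply_nonneg _ _)

end

end RestrictedAnosov

theorem mainTheorem6 {Γ Y : Type*} [Group Γ] [TopologicalSpace Y] [MulAction Γ Y]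
    (φ : RestrictedAnosov.GammaFlow Γ Y) (hφ : φ.IsCocompact)
    (K : Type*) [RCLike K] (d k : ℕ) :
    @IsOpen _ (RestrictedAnosov.homTopology Γ d K)
      {ρ : Γ →* Matrix.SpecialLinearGroup (Fin d) K |
        RestrictedAnosov.IsAnosovInRestriction φ k ρ} := by
  let := RestrictedAnosov.homTopology Γ d K
  exact isOpen_iff_mem_nhds.2 fun ρ hρ => RestrictedAnosov.IsAnosovInRestriction.eventually hφ hρ
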